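/- Let $\mathbf k$ be an algebraically closed field of characteristic zero, $T=\mathbb G_m^n$ a torus, $N=\mathbb Z^n$ and $M=\operatorname{Hom}_{\mathbb Z}(N,\mathbb Z)=\mathbb Z^n$ its lattices of one-parameter subgroups and of characters ($\chi^m(t)=t_1^{m_1}\cdots t_n^{m_n}$ for $m\in M$), $N_{\mathbb R}=\mathbb R^n$, $M_{\mathbb R}=\mathbb R^n$, with the standard pairing $\langle\cdot,\cdot\rangle$. For a strongly convex rational polyhedral cone $\sigma\subset N_{\mathbb R}$ let $\sigma^\vee=\{u\in M_{\mathbb R}: \langle u,v\rangle\ge 0 \text{ for all } v\in\sigma\}$ and $X_\sigma=\operatorname{Spec}\mathbf k[\sigma^\vee\cap M]$; for a (nonempty, finite) fan $\Sigma$ of such cones let $X_\Sigma$ be the toric variety glued from the $X_\tau$, $\tau\in\Sigma$, along common faces. The torus acts on these varieties in such a way that $\chi^m$ is a semi-invariant of weight $m$ for the induced action $(t\cdot f)(x)=f(t^{-1}x)$ on functions, i.e. $t\cdot\chi^m=\chi^m(t)\chi^m$. A $\mathbb G_a$-action on $X_\Sigma$, written as a homomorphism $\varepsilon\colon\mathbb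 G_a\to\operatorname{Aut}(X_\Sigma)$, is homogeneous of weight $e\in M$ if $t\circ\varepsilon(a)\circ t^{-1}=\varepsilon(\chi^e(t)\,a)$ for all $t\in T$ and $a\in\mathbb G_a$. (Equivalently, for quasi-affine $X_\Sigma$, the corresponding locally nilpotent derivation of $\mathcal O(X_\Sigma)$ is homogeneous of degree $e$ for the $M$-grading.) Let $D(X_\Sigma)\subset M$ be the set of weights of non-trivial homogeneous $\mathbb G_a$-actions on $X_\Sigma$. For $D\subset M_{\mathbb R}$ the asymptotic cone $D_\infty$ is the set of all $x\in M_{\mathbb R}$ for which there are $x_i\in D$ and real numbers $s_i\to+\infty$ with $x_i/s_i\to x$. For a cone $C\subset M_{\mathbb R}$ let $\operatorname{int}(C)$ be its topological interior inside its linear span. **Corollary.** Let $X=X_\Sigma$ be quasi-affine, and let $\sigma\subset N_{\mathbb R}$ be a strongly convex rational polyhedral cone with $X_{\mathrm{aff}}:=\operatorname{Spec}\mathcal O(X)=X_\sigma$ ($T$-equivariantly over $\mathbf k$). Then $$D(X)_\infty=\sigma^\vee\setminus\operatorname{int}(\sigma^\vee).$$ -/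

import Mathlib

open AlgebraicGeometry CategoryTheory Limits

universe u

noncomputable section

namespace Toric

/-- The inclusion of the lattice `ℤⁿ` into the real vector space `ℝⁿ`. -/
def toReal {n : ℕ} (m : Fin n → ℤ) : Fin n → ℝ := fun i => (m i : ℝ)

/-- A strongly convex rational polyhedral cone in `N_ℝ = ℝⁿ`: generated by finitely many vectors of
the lattice `N = ℤⁿ` and containing no nonzero linear subspace. -/
structure IsRationalCone {n : ℕ} (σ : PointedCone ℝ (Fin n → ℝ)) : Prop where
  exists_generators : ∃ S : Finset (Fin n → ℤ), σ = PointedCone.hull ℝ (toReal '' (S : Set (Fin n → ℤ)))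
  salient : (σ : ConvexCone ℝ (Fin n → ℝ)).Salient

/-- The dual cone `σ^∨` in `M_ℝ = ℝⁿ`. -/
def dualCone {n : ℕ} (σ : PointedCone ℝ (Fin n → ℝ)) : PointedCone ℝ (Fin n → ℝ) :=
  PointedCone.dual (dotProductBilin ℝ ℝ) (σ : Set (Fin n → ℝ))

theorem mem_dualCone {n : ℕ} {σ : PointedCone ℝ (Fin n → ℝ)} {u : Fin n → ℝ} :
    u ∈ dualCone σ ↔ ∀ v ∈ σ, 0 ≤ v ⬝ᵥ u := Iff.rfl

/-- `F` is a face of `σ`: `F = σ ∩ u^⊥` for some `u ∈ σ^∨`. -/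
def IsFace {n : ℕ} (F σ : PointedCone ℝ (Fin n → ℝ)) : Prop :=
  ∃ u ∈ dualCone σ, ∀ v, v ∈ F ↔ v ∈ σ ∧ v ⬝ᵥ u = 0

/-- The monoid `σ^∨_M = σ^∨ ∩ M`. -/
def dualMonoid {n : ℕ} (σ : PointedCone ℝ (Fin n → ℝ)) : AddSubmonoid (Fin n → ℤ) where
  carrier := {m | toReal m ∈ dualCone σ}
  zero_mem' := by
    have : toReal (0 : Fin n → ℤ) = 0 := by ext; simp [toReal]
    simp [this]
  add_mem' := by
    intro a b ha hb
    have : toReal (a + b) = toReal a + toReal b := by ext; simp [toReal]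
    simpa [this] using (dualCone σ).add_mem ha hb

theorem mem_dualMonoid {n : ℕ} {σ : PointedCone ℝ (Fin n → ℝ)} {m : Fin n → ℤ} :
    m ∈ dualMonoid σ ↔ toReal m ∈ dualCone σ := Iff.rfl

theorem dualMonoid_anti {n : ℕ} {σ τ : PointedCone ℝ (Fin n → ℝ)} (h : τ ≤ σ) :
    dualMonoid σ ≤ dualMonoid τ := fun _ hm _ hv => hm (h hv)

theorem toReal_dotProduct {n : ℕ} (a b : Fin n → ℤ) :
    toReal a ⬝ᵥ toReal b = ((a ⬝ᵥ b : ℤ) : ℝ) := by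
  simp [toReal, dotProduct]

theorem mem_dualCone_hull {n : ℕ} (S : Set (Fin n → ℤ)) (u : Fin n → ℝ) :
    u ∈ dualCone (PointedCone.hull ℝ (toReal '' S)) ↔ ∀ s ∈ S, 0 ≤ toReal s ⬝ᵥ u := by
  unfold dualCone
  rw [PointedCone.dual_hull]
  simp [PointedCone.mem_dual, dotProductBilin]

/-- A real vector `u` may be replaced by an integral one without changing on which of finitely many
integral vectors it vanishes or is positive. -/
theorem exists_int_approx {n : ℕ} (S : Finset (Fin n → ℤ)) (u : Fin n → ℝ) :
    ∃ w : Fin n → ℤ, ∀ s ∈ S,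
      (toReal s ⬝ᵥ u = 0 → s ⬝ᵥ w = 0) ∧ (0 < toReal s ⬝ᵥ u → 0 < s ⬝ᵥ w) := by
  classical
  let V := Submodule.span ℚ (Set.range u)
  have : Module.Finite ℚ V := FiniteDimensional.span_of_finite ℚ (Set.finite_range u)
  let b := Module.finBasis ℚ V
  let c : Fin n → Fin (Module.finrank ℚ V) → ℚ :=
    fun j l => b.repr ⟨u j, Submodule.subset_span ⟨j, rfl⟩⟩ l
  have hc : ∀ j, u j = ∑ l, (c j l : ℝ) * (b l : ℝ) := by
    intro j
    have := congrArg (fun x : V => (x : ℝ))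
      (b.sum_repr ⟨u j, Submodule.subset_span ⟨j, rfl⟩⟩)
    simp only [Submodule.coe_sum, Submodule.coe_smul, Rat.smul_def] at this
    exact this.symm
  let a : (Fin n → ℤ) → Fin (Module.finrank ℚ V) → ℚ := fun s l => ∑ j, (s j : ℚ) * c j l
  have ha : ∀ s, toReal s ⬝ᵥ u = ∑ l, (a s l : ℝ) * (b l : ℝ) := by
    intro s
    simp only [dotProduct, toReal, a]
    push_cast
    simp_rw [hc, Finset.mul_sum, Finset.sum_mul]
    rw [Finset.sum_comm]
    simp_rw [mul_assoc]
  have ha0 : ∀ s, toReal s ⬝ᵥ u = 0 → ∀ l, a s l = 0 := by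
    intro s hs
    rw [ha] at hs
    have hli := Fintype.linearIndependent_iff.1 b.linearIndependent (a s)
    apply hli
    apply Subtype.ext
    simpa [Rat.smul_def] using hs
  have hopen : IsOpen {q : Fin (Module.finrank ℚ V) → ℝ |
      ∀ s ∈ S.filter (fun s => 0 < toReal s ⬝ᵥ u), 0 < ∑ l, (a s l : ℝ) * q l} := by
    have : {q : Fin (Module.finrank ℚ V) → ℝ |
      ∀ s ∈ S.filter (fun s => 0 < toReal s ⬝ᵥ u), 0 < ∑ l, (a s l : ℝ) * q l} =
      ⋂ s ∈ S.filter (fun s => 0 < toReal s ⬝ᵥ u), {q | 0 < ∑ l, (a s l : ℝ) * q l} := by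
      ext; simp
    rw [this]
    apply isOpen_biInter_finset
    intro s _
    exact isOpen_lt continuous_const (by fun_prop)
  have hdense : DenseRange (Pi.map (fun (_ : Fin (Module.finrank ℚ V)) => ((↑) : ℚ → ℝ))) :=
    DenseRange.piMap (fun _ => Rat.denseRange_cast)
  obtain ⟨q, hq⟩ := hdense.exists_mem_open hopen ⟨fun l => (b l : ℝ), by
    intro s hs
    rw [← ha]
    exact (Finset.mem_filter.1 hs).2⟩
  let wq : Fin n → ℚ := fun j => ∑ l, c j l * q l
  obtain ⟨D, hD⟩ := IsLocalization.exist_integer_multiples_of_finite (nonZeroDivisors ℤ) wq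
  choose w' hw' using hD
  have hDne : (D : ℤ) ≠ 0 := nonZeroDivisors.ne_zero D.2
  have key : ∀ s : Fin n → ℤ, ((s ⬝ᵥ (fun j => (D : ℤ) * w' j) : ℤ) : ℚ)
      = ((D : ℤ) : ℚ) ^ 2 * ∑ l, a s l * q l := by
    intro s
    simp only [dotProduct]
    push_cast
    have : ∀ j, ((w' j : ℤ) : ℚ) = (D : ℤ) * wq j := by
      intro j
      have := hw' j
      simpa using this
    simp_rw [this, a, wq, Finset.sum_mul, Finset.mul_sum]
    rw [Finset.sum_comm]
    refine Finset.sum_congr rfl fun l _ => Finset.sum_congr rfl fun j _ => by ring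
  refine ⟨fun j => (D : ℤ) * w' j, fun s hs => ⟨fun h => ?_, fun h => ?_⟩⟩
  · have := key s
    simp only [ha0 s h, zero_mul, Finset.sum_const_zero, mul_zero] at this
    exact_mod_cast this
  · have h1 : (0 : ℝ) < ∑ l, (a s l : ℝ) * (q l : ℝ) :=
      hq s (Finset.mem_filter.2 ⟨hs, h⟩)
    have h2 : (0 : ℚ) < ∑ l, a s l * q l := by exact_mod_cast h1
    have h3 : (0 : ℚ) < ((s ⬝ᵥ (fun j => (D : ℤ) * w' j) : ℤ) : ℚ) := by
      rw [key]; positivity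
    exact_mod_cast h3

/-- A face of a rational cone is cut out by an element of `σ^∨_M`. -/
theorem IsFace.exists_int {n : ℕ} {F σ : PointedCone ℝ (Fin n → ℝ)} (hσ : IsRationalCone σ)
    (h : IsFace F σ) : ∃ w ∈ dualMonoid σ, ∀ v, v ∈ F ↔ v ∈ σ ∧ v ⬝ᵥ toReal w = 0 := by
  classical
  obtain ⟨S, rfl⟩ := hσ.exists_generators
  obtain ⟨u, hu, hF⟩ := h
  obtain ⟨w, hw⟩ := exists_int_approx S u
  have hu' := (mem_dualCone_hull _ _).1 hu
  have hw0 : ∀ s ∈ S, 0 ≤ s ⬝ᵥ w := by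
    intro s hs
    rcases (hu' s hs).eq_or_lt with h0 | h0
    · exact ((hw s hs).1 h0.symm).ge
    · exact ((hw s hs).2 h0).le
  have hwmem : w ∈ dualMonoid (PointedCone.hull ℝ (toReal '' (S : Set (Fin n → ℤ)))) := by
    rw [mem_dualMonoid, mem_dualCone_hull]
    intro s hs
    rw [toReal_dotProduct]
    exact_mod_cast hw0 s hs
  have hFw : ∀ v, v ∈ F ↔ v ∈ PointedCone.hull ℝ (toReal '' (S : Set (Fin n → ℤ))) ∧
      v ⬝ᵥ toReal w = 0 := by
    have hK : ∀ x y : Fin n → ℝ, (∀ s ∈ S, 0 ≤ toReal s ⬝ᵥ x) → (∀ s ∈ S, 0 ≤ toReal s ⬝ᵥ y) →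
        (∀ s ∈ S, toReal s ⬝ᵥ y = 0 → toReal s ⬝ᵥ x = 0) →
        ∀ v ∈ PointedCone.hull ℝ (toReal '' (S : Set (Fin n → ℤ))), v ⬝ᵥ y = 0 → v ⬝ᵥ x = 0 := by
      intro x y hx hy hxy v hv hvy
      have hK1 : ∃ K : ℝ, ∀ s ∈ S, 0 ≤ toReal s ⬝ᵥ (K • y - x) := by
        refine ⟨∑ s ∈ S, (toReal s ⬝ᵥ x) / (toReal s ⬝ᵥ y), fun s hs => ?_⟩
        rw [dotProduct_sub, dotProduct_smul, smul_eq_mul, sub_nonneg]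
        rcases (hy s hs).eq_or_lt with h0 | h0
        · simp [hxy s hs h0.symm, ← h0]
        · rw [← div_le_iff₀ h0]
          exact Finset.single_le_sum (f := fun s => (toReal s ⬝ᵥ x) / (toReal s ⬝ᵥ y))
            (fun i hi => div_nonneg (hx i hi) (hy i hi)) hs
      obtain ⟨K, hK⟩ := hK1
      have h1 := mem_dualCone.1 ((mem_dualCone_hull _ _).2 hK) v hv
      have h2 := mem_dualCone.1 ((mem_dualCone_hull _ _).2 hx) v hv
      rw [dotProduct_sub, dotProduct_smul, hvy, smul_zero] at h1
      linarith
    have hwr : ∀ s ∈ S, 0 ≤ toReal s ⬝ᵥ toReal w := by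
      intro s hs; rw [toReal_dotProduct]; exact_mod_cast hw0 s hs
    intro v
    rw [hF]
    refine and_congr_right fun hv => ⟨hK _ _ hwr hu' ?_ v hv, hK _ _ hu' hwr ?_ v hv⟩
    · intro s hs h0
      rw [toReal_dotProduct]
      exact_mod_cast (hw s hs).1 h0
    · intro s hs h0
      rw [toReal_dotProduct] at h0
      by_contra hne
      have := (hw s hs).2 (lt_of_le_of_ne (hu' s hs) (Ne.symm hne))
      have h0' : s ⬝ᵥ w = 0 := by exact_mod_cast h0
      omega
  exact ⟨w, hwmem, hFw⟩

theorem exists_add_nsmul_mem {n : ℕ} {F σ : PointedCone ℝ (Fin n → ℝ)} (hσ : IsRationalCone σ)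
    {w : Fin n → ℤ} (hwσ : w ∈ dualMonoid σ) (hF : ∀ v, v ∈ F ↔ v ∈ σ ∧ v ⬝ᵥ toReal w = 0)
    {m : Fin n → ℤ} (hm : m ∈ dualMonoid F) : ∃ N : ℕ, m + N • w ∈ dualMonoid σ := by
  classical
  obtain ⟨S, rfl⟩ := hσ.exists_generators
  have hw0 : ∀ s ∈ S, 0 ≤ s ⬝ᵥ w := by
    intro s hs
    have := (mem_dualCone_hull _ _).1 (mem_dualMonoid.1 hwσ) s hs
    rw [toReal_dotProduct] at this
    exact_mod_cast this
  refine ⟨∑ s ∈ S, (s ⬝ᵥ m).natAbs, ?_⟩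
  rw [mem_dualMonoid, mem_dualCone_hull]
  intro s hs
  rw [toReal_dotProduct]
  norm_cast
  rw [dotProduct_add, dotProduct_smul]
  rcases (hw0 s hs).eq_or_lt with h0 | h0
  · rw [← h0, smul_zero, add_zero]
    have hsF : toReal s ∈ F := (hF _).2 ⟨Submodule.subset_span ⟨s, hs, rfl⟩, by
      rw [toReal_dotProduct, ← h0]; simp⟩
    have := mem_dualCone.1 (mem_dualMonoid.1 hm) _ hsF
    rw [toReal_dotProduct] at this
    exact_mod_cast this
  · have h1 : (s ⬝ᵥ m).natAbs ≤ ∑ s ∈ S, (s ⬝ᵥ m).natAbs :=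
      Finset.single_le_sum (f := fun s => (s ⬝ᵥ m).natAbs) (fun _ _ => Nat.zero_le _) hs
    have h2 : -(s ⬝ᵥ m) ≤ ((∑ s ∈ S, (s ⬝ᵥ m).natAbs : ℕ) : ℤ) := by omega
    rw [nsmul_eq_mul]
    nlinarith

section Localization

variable (k : Type u) [Field k]

/-- The inclusion `k[P] → k[Q]` of monoid algebras for `P ≤ Q`. -/
def inclHom {G : Type} [AddCommGroup G] {P Q : AddSubmonoid G} (h : P ≤ Q) :
    AddMonoidAlgebra k P →+* AddMonoidAlgebra k Q :=
  AddMonoidAlgebra.mapDomainRingHom k (AddSubmonoid.inclusion h)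

theorem inclHom_single {G : Type} [AddCommGroup G] {P Q : AddSubmonoid G} (h : P ≤ Q) (p : P)
    (c : k) : inclHom k h (AddMonoidAlgebra.single p c) =
      AddMonoidAlgebra.single (⟨p, h p.2⟩ : Q) c := by
  simp [inclHom, AddMonoidAlgebra.mapDomainRingHom_apply]
  rfl

theorem inclHom_injective {G : Type} [AddCommGroup G] {P Q : AddSubmonoid G} (h : P ≤ Q) :
    Function.Injective (inclHom k h) :=
  AddMonoidAlgebra.mapDomain_injective (AddSubmonoid.inclusion_injective h)

theorem isLocalization_away {G : Type} [AddCommGroup G] {P Q : AddSubmonoid G} (h : P ≤ Q)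
    (w : P) (hw : -(w : G) ∈ Q) (hN : ∀ m ∈ Q, ∃ N : ℕ, m + N • (w : G) ∈ P) :
    letI := (inclHom k h).toAlgebra
    IsLocalization.Away (AddMonoidAlgebra.single w (1 : k)) (AddMonoidAlgebra k Q) := by
  let := (inclHom k h).toAlgebra
  have hmap : ∀ x, algebraMap (AddMonoidAlgebra k P) (AddMonoidAlgebra k Q) x = inclHom k h x :=
    fun _ => rfl
  have hpow : ∀ N : ℕ, (AddMonoidAlgebra.single w (1 : k)) ^ N =
      AddMonoidAlgebra.single (N • w) (1 : k) := by
    intro N; simp [AddMonoidAlgebra.single_pow]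
  refine IsLocalization.Away.mk _ ?_ ?_ ?_
  · rw [hmap, inclHom_single]
    refine IsUnit.of_mul_eq_one (AddMonoidAlgebra.single (⟨-(w : G), hw⟩ : Q) 1) ?_
    rw [AddMonoidAlgebra.single_mul_single, AddMonoidAlgebra.one_def]
    congr 1
    · ext; simp
    · simp
  · intro s
    induction s using AddMonoidAlgebra.induction_linear with
    | zero => exact ⟨0, 0, by simp⟩
    | add f g hf hg =>
      obtain ⟨n₁, a₁, h₁⟩ := hf
      obtain ⟨n₂, a₂, h₂⟩ := hg
      refine ⟨n₁ + n₂, a₁ * AddMonoidAlgebra.single w (1 : k) ^ n₂ +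
        a₂ * AddMonoidAlgebra.single w (1 : k) ^ n₁, ?_⟩
      rw [map_add, map_mul, map_mul, ← h₁, ← h₂, map_pow, map_pow]
      ring
    | single q c =>
      obtain ⟨N, hN'⟩ := hN q q.2
      refine ⟨N, AddMonoidAlgebra.single ⟨_, hN'⟩ c, ?_⟩
      rw [← map_pow, hpow, hmap, hmap, inclHom_single, inclHom_single,
        AddMonoidAlgebra.single_mul_single, mul_one]
      congr 1
  · intro a b hab
    exact ⟨0, by rw [inclHom_injective k h hab]⟩

end Localization

section Affine

variable (k : Type u) [Field k] {n : ℕ}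

/-- The coordinate ring `k[σ^∨_M]` of the affine toric variety `X_σ`. -/
abbrev coordRing (σ : PointedCone ℝ (Fin n → ℝ)) : Type u := AddMonoidAlgebra k (dualMonoid σ)

/-- The affine toric variety `X_σ = Spec k[σ^∨_M]`. -/
abbrev affineToric (σ : PointedCone ℝ (Fin n → ℝ)) : Scheme.{u} :=
  Spec (CommRingCat.of (coordRing k σ))

/-- The structure morphism `X_σ ⟶ Spec k`. -/
def affineToricStr (σ : PointedCone ℝ (Fin n → ℝ)) :
    affineToric k σ ⟶ Spec (CommRingCat.of k) :=
  Spec.map (CommRingCat.ofHom (algebraMap k (coordRing k σ)))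

/-- The morphism `X_τ ⟶ X_σ` induced by an inclusion `τ ⊆ σ` of cones. -/
def affineToricMap {τ σ : PointedCone ℝ (Fin n → ℝ)} (h : τ ≤ σ) :
    affineToric k τ ⟶ affineToric k σ :=
  Spec.map (CommRingCat.ofHom (inclHom k (dualMonoid_anti h)))

theorem inclHom_comp_algebraMap {τ σ : PointedCone ℝ (Fin n → ℝ)} (h : τ ≤ σ) :
    (inclHom k (dualMonoid_anti h)).comp (algebraMap k (coordRing k σ)) =
      algebraMap k (coordRing k τ) := by
  exact RingHom.ext fun c => inclHom_single k (dualMonoid_anti h) 0 c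

theorem affineToricMap_str {τ σ : PointedCone ℝ (Fin n → ℝ)} (h : τ ≤ σ) :
    affineToricMap k h ≫ affineToricStr k σ = affineToricStr k τ := by
  unfold affineToricMap affineToricStr
  rw [← Spec.map_comp, ← CommRingCat.ofHom_comp, inclHom_comp_algebraMap k h]

theorem affineToricMap_refl (σ : PointedCone ℝ (Fin n → ℝ)) :
    affineToricMap k (le_refl σ) = 𝟙 _ := by
  have : inclHom k (dualMonoid_anti (le_refl σ)) = RingHom.id _ := by
    refine RingHom.ext fun x => ?_
    induction x using AddMonoidAlgebra.induction_linear with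
    | zero => simp
    | add f g hf hg => rw [map_add, hf, hg, map_add]
    | single q c => rw [inclHom_single]; rfl
  unfold affineToricMap
  rw [this]
  exact Spec.map_id _

theorem affineToricMap_comp {ρ τ σ : PointedCone ℝ (Fin n → ℝ)} (h : ρ ≤ τ) (h' : τ ≤ σ) :
    affineToricMap k h ≫ affineToricMap k h' = affineToricMap k (h.trans h') := by
  unfold affineToricMap
  rw [← Spec.map_comp, ← CommRingCat.ofHom_comp]
  congr 2
  refine RingHom.ext fun x => ?_
  induction x using AddMonoidAlgebra.induction_linear with
  | zero => simp
  | add f g hf hg => rw [map_add, hf, hg, map_add]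
  | single q c => rw [RingHom.comp_apply, inclHom_single, inclHom_single, inclHom_single]

theorem IsFace.le {τ σ : PointedCone ℝ (Fin n → ℝ)} (h : IsFace τ σ) : τ ≤ σ := by
  obtain ⟨u, -, hu⟩ := h
  exact fun v hv => ((hu v).1 hv).1

/-- If `τ = σ ∩ w^⊥` with `w ∈ σ^∨_M`, then `X_τ ⟶ X_σ` is an open immersion onto the principal
open subset `D(χ^w)`. -/
theorem affineToricMap_face {τ σ : PointedCone ℝ (Fin n → ℝ)} (hσ : IsRationalCone σ)
    (w : dualMonoid σ) (hF : ∀ v, v ∈ τ ↔ v ∈ σ ∧ v ⬝ᵥ toReal w = 0) (h : τ ≤ σ) :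
    IsOpenImmersion (affineToricMap k h) ∧
      Set.range (affineToricMap k h) =
        ((PrimeSpectrum.basicOpen (AddMonoidAlgebra.single w (1 : k)) :
          TopologicalSpace.Opens (PrimeSpectrum (coordRing k σ))) :
            Set (PrimeSpectrum (coordRing k σ))) := by
  let := (inclHom k (dualMonoid_anti h)).toAlgebra
  have hneg : -(w : Fin n → ℤ) ∈ dualMonoid τ := by
    intro v hv
    have : toReal (-(w : Fin n → ℤ)) = -toReal (w : Fin n → ℤ) := by ext; simp [toReal]
    change 0 ≤ v ⬝ᵥ toReal (-(w : Fin n → ℤ))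
    rw [this, dotProduct_neg, ((hF v).1 hv).2, neg_zero]
  have hloc : IsLocalization.Away (AddMonoidAlgebra.single w (1 : k)) (coordRing k τ) :=
    isLocalization_away k (dualMonoid_anti h) w hneg
      fun m hm => exists_add_nsmul_mem hσ w.2 hF hm
  exact ⟨IsOpenImmersion.of_isLocalization (S := coordRing k τ)
      (AddMonoidAlgebra.single w (1 : k)),
    PrimeSpectrum.localization_away_comap_range (coordRing k τ)
      (AddMonoidAlgebra.single w (1 : k))⟩

end Affine

/-- A fan in `N_ℝ = ℝⁿ`: a finite nonempty set of strongly convex rational polyhedral cones, closed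
under taking faces, in which any two cones meet along a common face. -/
structure ConeFan (n : ℕ) where
  cones : Finset (PointedCone ℝ (Fin n → ℝ))
  nonempty : cones.Nonempty
  rational : ∀ σ ∈ cones, IsRationalCone σ
  face_mem : ∀ σ ∈ cones, ∀ τ, IsFace τ σ → τ ∈ cones
  inter_face : ∀ σ ∈ cones, ∀ τ ∈ cones, IsFace (σ ⊓ τ) σ ∧ IsFace (σ ⊓ τ) τ

section Glue

variable (k : Type u) [Field k] {n : ℕ} (Δ : ConeFan n)

theorem ConeFan.isFace_of_le {τ σ : PointedCone ℝ (Fin n → ℝ)} (hτ : τ ∈ Δ.cones)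
    (hσ : σ ∈ Δ.cones) (h : τ ≤ σ) : IsFace τ σ := by
  have := (Δ.inter_face τ hτ σ hσ).2
  rwa [inf_eq_left.2 h] at this

/-- The diagram of the affine toric varieties `X_σ` and open immersions `X_τ ⟶ X_σ` for
`τ ⊆ σ` in the fan. -/
def chartDiagram : {σ // σ ∈ Δ.cones} ⥤ Scheme.{u} where
  obj σ := affineToric k σ.1
  map f := affineToricMap k (leOfHom f)
  map_id σ := affineToricMap_refl k σ.1
  map_comp f g := (affineToricMap_comp k (leOfHom f) (leOfHom g)).symm

instance chartDiagram_isOpenImmersion {τ σ : {σ // σ ∈ Δ.cones}} (f : τ ⟶ σ) :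
    IsOpenImmersion ((chartDiagram k Δ).map f) := by
  obtain ⟨w, hw, hF⟩ := (Δ.isFace_of_le τ.2 σ.2 (leOfHom f)).exists_int (Δ.rational _ σ.2)
  exact (affineToricMap_face k (Δ.rational _ σ.2) ⟨w, hw⟩ hF (leOfHom f)).1

instance chartDiagram_isLocallyDirected :
    (chartDiagram k Δ ⋙ Scheme.forget).IsLocallyDirected := by
  constructor
  intro i j l fi fj xi xj hx
  have hl := Δ.rational _ l.2
  obtain ⟨wi, hwi, hFi⟩ := (Δ.isFace_of_le i.2 l.2 (leOfHom fi)).exists_int hl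
  obtain ⟨wj, hwj, hFj⟩ := (Δ.isFace_of_le j.2 l.2 (leOfHom fj)).exists_int hl
  have hri := (affineToricMap_face k hl ⟨wi, hwi⟩ hFi (leOfHom fi)).2
  have hrj := (affineToricMap_face k hl ⟨wj, hwj⟩ hFj (leOfHom fj)).2
  let m : {σ // σ ∈ Δ.cones} := ⟨i.1 ⊓ j.1, Δ.face_mem _ i.2 _ (Δ.inter_face _ i.2 _ j.2).1⟩
  let fmi : m ⟶ i := homOfLE (inf_le_left : i.1 ⊓ j.1 ≤ i.1)
  let fmj : m ⟶ j := homOfLE (inf_le_right : i.1 ⊓ j.1 ≤ j.1)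
  have hFm : ∀ v, v ∈ m.1 ↔ v ∈ l.1 ∧ v ⬝ᵥ toReal (wi + wj) = 0 := by
    intro v
    have hadd : toReal (wi + wj) = toReal wi + toReal wj := by ext; simp [toReal]
    rw [hadd, dotProduct_add]
    change v ∈ i.1 ∧ v ∈ j.1 ↔ _
    rw [hFi, hFj]
    constructor
    · rintro ⟨⟨h, h1⟩, -, h2⟩
      exact ⟨h, by rw [h1, h2, add_zero]⟩
    · rintro ⟨h, h0⟩
      have h1 := mem_dualCone.1 (mem_dualMonoid.1 hwi) v h
      have h2 := mem_dualCone.1 (mem_dualMonoid.1 hwj) v h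
      exact ⟨⟨h, by linarith⟩, h, by linarith⟩
  have hrm := (affineToricMap_face k hl ⟨wi + wj, (dualMonoid l.1).add_mem hwi hwj⟩ hFm
    (leOfHom (fmi ≫ fi))).2
  have hmem : affineToricMap k (leOfHom fi) xi ∈
      Set.range (affineToricMap k (leOfHom (fmi ≫ fi))) := by
    have h1 : affineToricMap k (leOfHom fi) xi ∈ Set.range (affineToricMap k (leOfHom fi)) :=
      ⟨xi, rfl⟩
    have h2 : affineToricMap k (leOfHom fi) xi ∈ Set.range (affineToricMap k (leOfHom fj)) :=
      ⟨xj, hx.symm⟩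
    rw [hri] at h1
    rw [hrj] at h2
    rw [hrm]
    have hmul : AddMonoidAlgebra.single
        (⟨wi + wj, (dualMonoid l.1).add_mem hwi hwj⟩ : dualMonoid l.1) (1 : k) =
        AddMonoidAlgebra.single (⟨wi, hwi⟩ : dualMonoid l.1) (1 : k) *
        AddMonoidAlgebra.single (⟨wj, hwj⟩ : dualMonoid l.1) (1 : k) := by
      rw [AddMonoidAlgebra.single_mul_single, mul_one]; rfl
    rw [hmul, PrimeSpectrum.basicOpen_mul]
    exact ⟨h1, h2⟩
  obtain ⟨x, hxm⟩ := hmem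
  have hcomp : ∀ {c : {σ // σ ∈ Δ.cones}} (f : m ⟶ c) (g : c ⟶ l),
      affineToricMap k (leOfHom g) (affineToricMap k (leOfHom f) x) =
        affineToricMap k (leOfHom fi) xi := by
    intro c f g
    rw [← Scheme.Hom.comp_apply, affineToricMap_comp]
    exact hxm
  refine ⟨m, fmi, fmj, x, ?_, ?_⟩
  · exact ((chartDiagram k Δ).map fi).isOpenEmbedding.injective (hcomp fmi fi)
  · exact ((chartDiagram k Δ).map fj).isOpenEmbedding.injective ((hcomp fmj fj).trans hx)

instance : HasColimit (chartDiagram k Δ) := inferInstance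

/-- The toric variety `X_Σ` of a fan, glued from the affine toric varieties of its cones. -/
def toricVariety : Scheme.{u} := colimit (chartDiagram k Δ)

/-- The structure morphism `X_Σ ⟶ Spec k`. -/
def toricStr : toricVariety k Δ ⟶ Spec (CommRingCat.of k) :=
  colimit.desc (chartDiagram k Δ)
    { pt := Spec (CommRingCat.of k)
      ι := { app := fun σ => affineToricStr k σ.1
             naturality := fun _ _ f =>
               (affineToricMap_str k (leOfHom f)).trans (Category.comp_id _).symm } }

end Glue

section Torus

variable {k : Type u} [Field k] {n : ℕ}

/-- The value `χ^m(t) = t₁^{m₁} ⋯ tₙ^{mₙ}` of the character `χ^m` of the torus `T = 𝔾ₘⁿ` at a point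
`t ∈ T(k) = (kˣ)ⁿ`. -/
def character (m : Fin n → ℤ) (t : Fin n → kˣ) : kˣ := ∏ i, t i ^ m i

/-- The action of `t ∈ T(k)` on the functions on `X_σ`: `t · χ^m = χ^m(t) χ^m`. -/
def torusOnFunctions (σ : PointedCone ℝ (Fin n → ℝ)) (t : Fin n → kˣ) :
    coordRing k σ →ₐ[k] coordRing k σ :=
  AddMonoidAlgebra.lift k (coordRing k σ) (dualMonoid σ)
    { toFun := fun m => AddMonoidAlgebra.single m.toAdd (character (m.toAdd : Fin n → ℤ) t : k)
      map_one' := by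
        simp [character, AddMonoidAlgebra.one_def]
      map_mul' := by
        intro a b
        rw [AddMonoidAlgebra.single_mul_single]
        congr 1
        simp [character, zpow_add, Finset.prod_mul_distrib] }

theorem torusOnFunctions_single (σ : PointedCone ℝ (Fin n → ℝ)) (t : Fin n → kˣ)
    (m : dualMonoid σ) (c : k) :
    torusOnFunctions σ t (AddMonoidAlgebra.single m c) =
      AddMonoidAlgebra.single m (c * character (m : Fin n → ℤ) t) := by
  simp [torusOnFunctions, AddMonoidAlgebra.lift_single]

/-- The automorphism of `X_σ` by which `t ∈ T(k)` acts. The action of `T` on functions is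
`(t · f)(x) = f(t⁻¹ · x)`, so `t` acts on `X_σ` by the morphism whose comorphism is `f ↦ t⁻¹ · f`. -/
def affineTorusAct (σ : PointedCone ℝ (Fin n → ℝ)) (t : Fin n → kˣ) :
    affineToric k σ ⟶ affineToric k σ :=
  Spec.map (CommRingCat.ofHom (torusOnFunctions σ t⁻¹).toRingHom)

theorem affineTorusAct_naturality {τ σ : PointedCone ℝ (Fin n → ℝ)} (h : τ ≤ σ)
    (t : Fin n → kˣ) :
    affineToricMap k h ≫ affineTorusAct σ t = affineTorusAct τ t ≫ affineToricMap k h := by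
  unfold affineToricMap affineTorusAct
  rw [← Spec.map_comp, ← Spec.map_comp, ← CommRingCat.ofHom_comp, ← CommRingCat.ofHom_comp]
  congr 2
  refine RingHom.ext fun x => ?_
  induction x using AddMonoidAlgebra.induction_linear with
  | zero => simp
  | add f g hf hg => rw [map_add, hf, hg, map_add]
  | single q c =>
    simp only [RingHom.comp_apply, AlgHom.toRingHom_eq_coe, RingHom.coe_coe, inclHom_single,
      torusOnFunctions_single]

/-- The automorphism of `X_Σ` by which `t ∈ T(k)` acts, glued from its action on the charts. -/
def torusAct (Δ : ConeFan n) (t : Fin n → kˣ) : toricVariety k Δ ⟶ toricVariety k Δ :=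
  colimMap
    { app := fun σ => affineTorusAct σ.1 t
      naturality := fun _ _ f => affineTorusAct_naturality (leOfHom f) t }

end Torus

section GaActions

/-- An action of the additive group `𝔾ₐ` on a scheme `X` over `Spec k`: a morphism
`𝔾ₐ ×ₖ X = 𝔸¹_X ⟶ X` over `Spec k` that satisfies the axioms of an action. They are stated on `S`-valued
points: `a ∈ 𝔾ₐ(S) = Γ(S, 𝒪_S)` moves `x ∈ X(S)` to the composite `S ⟶ 𝔸¹_X ⟶ X`. -/
structure GaAction {k : Type u} [Field k] {X : Scheme.{u}} (p : X ⟶ Spec (CommRingCat.of k)) where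
  act : 𝔸(PUnit.{u + 1}; X) ⟶ X
  act_over : act ≫ p = (𝔸(PUnit.{u + 1}; X) ↘ X) ≫ p
  zero_act : ∀ {S : Scheme.{u}} (x : S ⟶ X),
    AffineSpace.homOfVector x (fun _ => (0 : Γ(S, ⊤))) ≫ act = x
  add_act : ∀ {S : Scheme.{u}} (x : S ⟶ X) (a b : Γ(S, ⊤)),
    AffineSpace.homOfVector x (fun _ => a + b) ≫ act =
      AffineSpace.homOfVector (AffineSpace.homOfVector x (fun _ => b) ≫ act) (fun _ => a) ≫ act

variable {k : Type u} [Field k]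

/-- The point `a · x ∈ X(S)` for `a ∈ 𝔾ₐ(S)` and `x ∈ X(S)`. -/
def GaAction.move {X : Scheme.{u}} {p : X ⟶ Spec (CommRingCat.of k)} (ε : GaAction p)
    {S : Scheme.{u}} (a : Γ(S, ⊤)) (x : S ⟶ X) : S ⟶ X :=
  AffineSpace.homOfVector x (fun _ => a) ≫ ε.act

/-- The action is trivial if it is the projection `𝔾ₐ ×ₖ X ⟶ X`. -/
def GaAction.IsTrivial {X : Scheme.{u}} {p : X ⟶ Spec (CommRingCat.of k)} (ε : GaAction p) : Prop :=
  ε.act = 𝔸(PUnit.{u + 1}; X) ↘ X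

/-- The constant function `c ∈ k` on a scheme over `Spec k`. -/
def constant {S : Scheme.{u}} (f : S ⟶ Spec (CommRingCat.of k)) (c : k) : Γ(S, ⊤) :=
  f.appTop ((Scheme.ΓSpecIso (CommRingCat.of k)).inv c)

/-- A `𝔾ₐ`-action `ε` on `X_Σ` is homogeneous of weight `e ∈ M` if
`t ∘ ε(a) ∘ t⁻¹ = ε(χ^e(t) a)` for all `t ∈ T(k)` and all points `a` of `𝔾ₐ`. -/
def IsHomogeneous {n : ℕ} {Δ : ConeFan n} (ε : GaAction (toricStr k Δ)) (e : Fin n → ℤ) : Prop :=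
  ∀ (t : Fin n → kˣ) {S : Scheme.{u}} (a : Γ(S, ⊤)) (x : S ⟶ toricVariety k Δ),
    ε.move a (x ≫ torusAct Δ t⁻¹) ≫ torusAct Δ t =
      ε.move (constant (x ≫ toricStr k Δ) (character e t : k) * a) x

variable (k) in
/-- The set `D(X_Σ) ⊆ M` of weights of nontrivial homogeneous `𝔾ₐ`-actions on `X_Σ`. -/
def weights {n : ℕ} (Δ : ConeFan n) : Set (Fin n → ℤ) :=
  {e | ∃ ε : GaAction (toricStr k Δ), ¬ ε.IsTrivial ∧ IsHomogeneous ε e}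

end GaActions

/-- `X_aff = X_σ`: the affine scheme `X_aff = Spec Γ(X, 𝒪_X)` of `X = X_Σ` is isomorphic to `X_σ`
over `Spec k`, equivariantly for the torus. -/
def AffinizationIs (k : Type u) [Field k] {n : ℕ} (Δ : ConeFan n)
    (σ : PointedCone ℝ (Fin n → ℝ)) : Prop :=
  ∃ φ : Spec Γ(toricVariety k Δ, ⊤) ≅ affineToric k σ,
    φ.hom ≫ affineToricStr k σ =
      Spec.map ((Scheme.ΓSpecIso (CommRingCat.of k)).inv ≫ (toricStr k Δ).appTop) ∧
    ∀ t : Fin n → kˣ,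
      Spec.map (torusAct Δ t).appTop ≫ φ.hom = φ.hom ≫ affineTorusAct σ t

end Toric

end

/-! Let `S` be the set of primitive ray generators of σ. As X is quasi-affine, it is a T-stable open
subset of X_σ with the same global functions. A 𝔾ₐ-action on X is therefore a coaction k[σ^∨_M] →
k[σ^∨_M][t] whose flow preserves X.

Inclusion ⊆. The linear term of the coaction of a nontrivial action of weight e is a nonzero locally
nilpotent derivation D of degree e. If e were in σ^∨, then D χ^m = l(m) χ^{m+e} with l additive, and
iterating D on a suitable character would never give zero; so ⟨s,e⟩ < 0 for some s in `S`
(`notMem_dualMonoid_of_locallyNilpotent`). On the other hand, a derivation is determined by its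
values on finitely many fixed characters χ^m. One of them has D χ^m ≠ 0, hence m + e ∈ σ^∨, and
⟨s,e⟩ ≥ -C with C independent of e (`exists_bound_of_derivation`). After rescaling, a limit x of
weights has all ⟨s,x⟩ ≥ 0, but not all of them positive.

Inclusion ⊇. A boundary point x is orthogonal to some s in `S`. Rounding jx and adding a bounded
correction gives lattice points e with ⟨s,e⟩ = -1, positive on the other generators, whose direction
tends to that of x (`mem_asymptoticCone_demazure`). Such an e is a Demazure root, and χ^m ↦ χ^m (1 +
χ^e t)^⟨s,m⟩ is an action on X_σ. It must be shown to preserve X. The complement of X is cut out by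
a radical ideal I spanned by characters. Some χ^w in I has ⟨s,w⟩ = 0
(`exists_chi_mem_boundaryIdeal`): otherwise the sets D(χ^m) with ⟨s,m⟩ > 0 cover X, and on them the
fractions χ^{m+e}/χ^m glue to a global function χ^e, although e ∉ σ^∨. As e is strictly positive
away from s, a power of χ^{m+e} is divisible by χ^w whenever ⟨s,m⟩ > 0, so χ^{m+e} ∈ I. Hence the
coaction maps I into I[t], and the flow, being invertible, cannot leave X. -/

noncomputable section

namespace Toric

/-! ### Convex geometry of rational cones and asymptotic directions -/

section Cones

open Filter Topology

/-- **Farkas' lemma** for a finite family of vectors of `ℝⁿ`. -/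
theorem exists_separating_of_forall_ne {n : ℕ} {m : ℕ} (a : Fin m → Fin n → ℝ) (b : Fin n → ℝ)
    (h : ∀ c : Fin m → ℝ, (∀ i, 0 ≤ c i) → b ≠ ∑ i, c i • a i) :
    ∃ v : Fin n → ℝ, (∀ i, 0 ≤ a i ⬝ᵥ v) ∧ b ⬝ᵥ v < 0 := by
  induction m generalizing b with
  | zero =>
    refine ⟨-b, fun i => i.elim0, ?_⟩
    have hb : b ≠ 0 := by simpa using h (fun i => i.elim0) (fun i => i.elim0)
    have := dotProduct_self_eq_zero.not.2 hb
    have h2 : 0 ≤ b ⬝ᵥ b := Finset.sum_nonneg fun i _ => mul_self_nonneg _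
    rw [dotProduct_neg]
    exact neg_lt_zero.2 (lt_of_le_of_ne h2 (Ne.symm this))
  | succ m ih =>
    by_cases h0 : ∃ v : Fin n → ℝ, (∀ i : Fin m, 0 ≤ a i.castSucc ⬝ᵥ v) ∧ b ⬝ᵥ v < 0
    · obtain ⟨v, hv, hbv⟩ := h0
      by_cases hl : 0 ≤ a (Fin.last m) ⬝ᵥ v
      · exact ⟨v, fun i => Fin.lastCases hl hv i, hbv⟩
      push Not at hl
      set l := a (Fin.last m) with hldef
      set t := l ⬝ᵥ v
      have hswap : ∀ x y : ℝ, x / t * y = y / t * x := fun x y => by ring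
      -- Here `v` separates `b` from the other vectors but is negative on `l`. The induction
      -- hypothesis is applied after projecting to v^⊥ along `l`; the signs make the coefficient of
      -- `l` nonnegative when a relation is lifted back.
      obtain ⟨w, hw, hbw⟩ := ih (fun i => a i.castSucc - ((a i.castSucc ⬝ᵥ v) / t) • l)
        (b - ((b ⬝ᵥ v) / t) • l) (by
          intro c hc heq
          refine h (Fin.snoc c ((b ⬝ᵥ v) / t - ∑ i, c i * ((a i.castSucc ⬝ᵥ v) / t))) ?_ ?_
          · intro i
            refine Fin.lastCases ?_ (fun i => ?_) i
            · rw [Fin.snoc_last, sub_nonneg]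
              refine (Finset.sum_nonpos fun i _ => ?_).trans (div_nonneg_of_nonpos hbv.le hl.le)
              exact mul_nonpos_of_nonneg_of_nonpos (hc i)
                (div_nonpos_of_nonneg_of_nonpos (hv i) hl.le)
            · rw [Fin.snoc_castSucc]; exact hc i
          · rw [Fin.sum_univ_castSucc]
            simp only [Fin.snoc_castSucc, Fin.snoc_last]
            rw [sub_eq_iff_eq_add] at heq
            rw [← hldef, sub_smul, Finset.sum_smul]
            conv_lhs => rw [heq]
            simp only [smul_sub, Finset.sum_sub_distrib, smul_smul]
            abel)
      -- The adjoint of the projection applied to `w`: it vanishes on `l` and takes on the other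
      -- vectors the values of `w` on their projections.
      refine ⟨w - ((l ⬝ᵥ w) / t) • v, fun i => ?_, ?_⟩
      · rw [dotProduct_sub, dotProduct_smul, smul_eq_mul]
        refine Fin.lastCases ?_ (fun i => ?_) i
        · rw [← hldef, div_mul_cancel₀ _ hl.ne, sub_self]
        · have := hw i
          rw [sub_dotProduct, smul_dotProduct, smul_eq_mul] at this
          rwa [hswap]
      · rw [sub_dotProduct, smul_dotProduct, smul_eq_mul] at hbw
        rwa [dotProduct_sub, dotProduct_smul, smul_eq_mul, hswap]
    · exfalso
      refine h0 (ih _ b fun c hc heq => h (Fin.snoc c 0) ?_ ?_)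
      · intro i
        refine Fin.lastCases ?_ (fun i => ?_) i
        · simp
        · simpa using hc i
      · rw [Fin.sum_univ_castSucc]
        simpa using heq

theorem exists_separating_of_notMem_hull {n : ℕ} (S : Finset (Fin n → ℤ)) (b : Fin n → ℝ)
    (h : b ∉ PointedCone.hull ℝ (toReal '' (S : Set (Fin n → ℤ)))) :
    ∃ v : Fin n → ℝ, (∀ s ∈ S, 0 ≤ toReal s ⬝ᵥ v) ∧ b ⬝ᵥ v < 0 := by
  let e := S.equivFin.symm
  obtain ⟨v, hv, hb⟩ := exists_separating_of_forall_ne (fun i => toReal (e i : Fin n → ℤ)) b (by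
    rintro c hc rfl
    refine h (Submodule.sum_mem _ fun i _ => ?_)
    exact Submodule.smul_mem _ (⟨c i, hc i⟩ : {c : ℝ // 0 ≤ c})
      (Submodule.subset_span ⟨_, (e i).2, rfl⟩))
  refine ⟨v, fun s hs => ?_, hb⟩
  simpa using hv (e.symm ⟨s, hs⟩)

theorem toReal_add {n : ℕ} (a b : Fin n → ℤ) : toReal (a + b) = toReal a + toReal b := by
  ext; simp [toReal]

theorem toReal_neg {n : ℕ} (a : Fin n → ℤ) : toReal (-a) = -toReal a := by
  ext; simp [toReal]

theorem toReal_zero {n : ℕ} : toReal (0 : Fin n → ℤ) = 0 := by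
  ext; simp [toReal]

theorem toReal_nsmul {n : ℕ} (N : ℕ) (a : Fin n → ℤ) : toReal (N • a) = (N : ℝ) • toReal a := by
  ext; simp [toReal]

theorem toReal_zsmul {n : ℕ} (N : ℤ) (a : Fin n → ℤ) : toReal (N • a) = (N : ℝ) • toReal a := by
  ext; simp [toReal]

theorem toReal_injective {n : ℕ} : Function.Injective (toReal (n := n)) := fun a b h => by
  ext i; simpa [toReal] using congrFun h i

theorem hull_toReal_le_iff {n : ℕ} (S : Set (Fin n → ℤ)) (τ : PointedCone ℝ (Fin n → ℝ)) :
    PointedCone.hull ℝ (toReal '' S) ≤ τ ↔ ∀ s ∈ S, toReal s ∈ τ := by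
  rw [PointedCone.hull, Submodule.span_le, Set.image_subset_iff]
  rfl

/-- Membership of a lattice vector in the dual monoid of a cone generated by lattice vectors. -/
theorem mem_dualMonoid_hull {n : ℕ} {S : Set (Fin n → ℤ)} {m : Fin n → ℤ} :
    m ∈ dualMonoid (PointedCone.hull ℝ (toReal '' S)) ↔ ∀ s ∈ S, 0 ≤ s ⬝ᵥ m := by
  rw [mem_dualMonoid, mem_dualCone_hull]
  simp only [toReal_dotProduct, Int.cast_nonneg_iff]

/-- A nonzero lattice vector is a positive multiple of one on which some integral linear form takes
the value one. -/
theorem exists_primitive {n : ℕ} (s : Fin n → ℤ) (hs : s ≠ 0) :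
    ∃ (d : ℕ) (p f : Fin n → ℤ), 0 < d ∧ s = d • p ∧ p ⬝ᵥ f = 1 := by
  obtain ⟨i, hi⟩ := Function.ne_iff.1 hs
  obtain ⟨p, hp, hp1⟩ := Finset.extract_gcd s ⟨i, Finset.mem_univ i⟩
  obtain ⟨f, hf⟩ := Finset.gcd_eq_sum_mul Finset.univ p
  have h0 : Finset.univ.gcd s ≠ 0 := fun h => hi (by
    simpa using Finset.gcd_eq_zero_iff.1 h i (Finset.mem_univ i))
  have hnn : 0 ≤ Finset.univ.gcd s := by
    rw [← Finset.normalize_gcd]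
    exact Int.nonneg_of_normalize_eq_self (by simp)
  refine ⟨(Finset.univ.gcd s).toNat, p, f, by omega, ?_, ?_⟩
  · ext j
    have := hp j (Finset.mem_univ j)
    simp only [Pi.smul_apply, nsmul_eq_mul, Int.toNat_of_nonneg hnn]
    exact this
  · rw [dotProduct, ← hp1, hf]

/-- By salience `-s` is outside the cone, so Farkas gives a form that is nonnegative on `S` and
positive at `s`. The sum of these forms over `S` is positive everywhere on `S`, and
`exists_int_approx` makes it integral. -/
theorem exists_pos_on_generators {n : ℕ} (S : Finset (Fin n → ℤ)) (h0 : ∀ s ∈ S, s ≠ 0)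
    (hS : (PointedCone.hull ℝ (toReal '' (S : Set (Fin n → ℤ))) :
      ConvexCone ℝ (Fin n → ℝ)).Salient) :
    ∃ u : Fin n → ℤ, ∀ s ∈ S, 0 < s ⬝ᵥ u := by
  classical
  have h1 : ∀ s ∈ S, ∃ v : Fin n → ℝ, (∀ s' ∈ S, 0 ≤ toReal s' ⬝ᵥ v) ∧ 0 < toReal s ⬝ᵥ v := by
    intro s hs
    obtain ⟨v, hv, hb⟩ := exists_separating_of_notMem_hull S (-toReal s)
      (hS (toReal s) (Submodule.subset_span ⟨s, hs, rfl⟩)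
        (fun h => h0 s hs (toReal_injective (h.trans toReal_zero.symm))))
    rw [neg_dotProduct, neg_lt_zero] at hb
    exact ⟨v, hv, hb⟩
  choose! v hv hpos using h1
  obtain ⟨w, hw⟩ := exists_int_approx S (∑ s ∈ S, v s)
  refine ⟨w, fun s hs => (hw s hs).2 ?_⟩
  rw [dotProduct_sum]
  exact Finset.sum_pos' (fun t ht => hv t ht s hs) ⟨s, hs, hpos s hs⟩

/-- A strongly convex rational cone is generated by the primitive generators of its rays: lattice
vectors `s`, each primitive and each cut out from the other ones by an integral supporting
hyperplane of the cone. -/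
theorem IsRationalCone.exists_primitive_generators {n : ℕ} {σ : PointedCone ℝ (Fin n → ℝ)}
    (hσ : IsRationalCone σ) :
    ∃ S : Finset (Fin n → ℤ), σ = PointedCone.hull ℝ (toReal '' (S : Set (Fin n → ℤ))) ∧
      (∃ u : Fin n → ℤ, ∀ s ∈ S, 0 < s ⬝ᵥ u) ∧
      ∀ s ∈ S, (∃ f : Fin n → ℤ, s ⬝ᵥ f = 1) ∧
        ∃ u : Fin n → ℤ, s ⬝ᵥ u = 0 ∧ ∀ s' ∈ S, s' ≠ s → 0 < s' ⬝ᵥ u := by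
  classical
  let good : Finset (Fin n → ℤ) → Prop := fun S =>
    σ = PointedCone.hull ℝ (toReal '' (S : Set (Fin n → ℤ))) ∧ ∀ s ∈ S, ∃ f : Fin n → ℤ, s ⬝ᵥ f = 1
  have hne : ∃ S, good S := by
    obtain ⟨S, hS⟩ := hσ.exists_generators
    choose! d p f hd hp hf using exists_primitive (n := n)
    refine ⟨(S.filter (· ≠ 0)).image p, ?_, ?_⟩
    · rw [hS]
      apply le_antisymm
      · rw [hull_toReal_le_iff]
        intro s hs
        by_cases h : s = 0
        · rw [h, toReal_zero]; exact Submodule.zero_mem _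
        · rw [hp s h, toReal_nsmul]
          refine Submodule.smul_mem _ (⟨(d s : ℝ), Nat.cast_nonneg _⟩ : {c : ℝ // 0 ≤ c})
            (Submodule.subset_span ⟨p s, ?_, rfl⟩)
          simp only [Finset.coe_image, Set.mem_image]
          exact ⟨s, by simpa using ⟨hs, h⟩, rfl⟩
      · rw [hull_toReal_le_iff]
        intro s hs
        simp only [Finset.coe_image, Set.mem_image, Finset.coe_filter, Set.mem_ofPred_eq] at hs
        obtain ⟨s, ⟨hs, h⟩, rfl⟩ := hs
        have h2 : toReal (p s) = ((d s : ℝ)⁻¹) • toReal s := by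
          have h3 := congrArg toReal (hp s h)
          rw [toReal_nsmul] at h3
          rw [h3, smul_smul, inv_mul_cancel₀, one_smul]
          exact_mod_cast (hd s h).ne'
        rw [h2]
        exact Submodule.smul_mem _ (⟨(d s : ℝ)⁻¹, by positivity⟩ : {c : ℝ // 0 ≤ c})
            (Submodule.subset_span ⟨s, hs, rfl⟩)
    · intro s hs
      simp only [Finset.mem_image, Finset.mem_filter] at hs
      obtain ⟨s, ⟨hs, h⟩, rfl⟩ := hs
      exact ⟨f s, hf s h⟩
  -- A generating set of primitive vectors of least cardinality: no element is in the cone of the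
  -- others, so Farkas separates it from them.
  obtain ⟨S, ⟨hS, hprim⟩, hmin⟩ := WellFounded.has_min (measure Finset.card).wf {S | good S} hne
  have h0 : ∀ s ∈ S, s ≠ 0 := by
    rintro s hs rfl
    obtain ⟨f, hf⟩ := hprim 0 hs
    simp at hf
  obtain ⟨u, hu⟩ := exists_pos_on_generators S h0 (hS ▸ hσ.salient)
  refine ⟨S, hS, ⟨u, hu⟩, fun s hs => ⟨hprim s hs, ?_⟩⟩
  have hnot : toReal s ∉
      PointedCone.hull ℝ (toReal '' ((S.erase s : Finset (Fin n → ℤ)) : Set (Fin n → ℤ))) := by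
    intro hmem
    refine hmin (S.erase s) ⟨?_, fun t ht => hprim t (Finset.mem_of_mem_erase ht)⟩
      (Finset.card_erase_lt_of_mem hs)
    rw [hS]
    apply le_antisymm
    · rw [hull_toReal_le_iff]
      intro t ht
      by_cases h : t = s
      · rwa [h]
      · exact Submodule.subset_span ⟨t, Finset.mem_erase.2 ⟨h, ht⟩, rfl⟩
    · exact Submodule.span_mono (Set.image_mono (Finset.coe_subset.2 (Finset.erase_subset _ _)))
  obtain ⟨v, hv, hvs⟩ := exists_separating_of_notMem_hull _ _ hnot
  have hur : ∀ t ∈ S, 0 < toReal t ⬝ᵥ toReal u := by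
    intro t ht
    rw [toReal_dotProduct]
    exact_mod_cast hu t ht
  -- `u` is positive on all generators, `v` is negative only on `s`; the coefficient of `v` is the
  -- one that makes the sum vanish at `s`.
  obtain ⟨w, hw⟩ := exists_int_approx S
    (toReal u + ((toReal s ⬝ᵥ toReal u) / -(toReal s ⬝ᵥ v)) • v)
  refine ⟨w, (hw s hs).1 ?_, fun t ht hts => (hw t ht).2 ?_⟩
  · rw [dotProduct_add, dotProduct_smul, smul_eq_mul]
    field_simp [hvs.ne]
    ring
  · rw [dotProduct_add, dotProduct_smul, smul_eq_mul]
    have := hv t (Finset.mem_erase.2 ⟨hts, ht⟩)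
    have h2 := hur s hs
    have h3 : 0 < -(toReal s ⬝ᵥ v) := neg_pos.2 hvs
    have := hur t ht
    positivity

/-- A point of the dual cone on which all generators are positive lies in its interior. -/
theorem mem_intrinsicInterior_dualCone {n : ℕ} (S : Finset (Fin n → ℤ)) {x : Fin n → ℝ}
    (hx : ∀ s ∈ S, 0 < toReal s ⬝ᵥ x) :
    x ∈ intrinsicInterior ℝ
      (dualCone (PointedCone.hull ℝ (toReal '' (S : Set (Fin n → ℤ)))) : Set (Fin n → ℝ)) := by
  apply interior_subset_intrinsicInterior
  rw [mem_interior]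
  refine ⟨⋂ s ∈ S, {y | 0 < toReal s ⬝ᵥ y}, ?_, ?_, by simpa using hx⟩
  · intro y hy
    simp only [Set.mem_iInter, Set.mem_ofPred_eq] at hy
    exact (mem_dualCone_hull _ _).2 fun s hs => (hy s hs).le
  · exact isOpen_biInter_finset fun s _ => isOpen_lt continuous_const (by fun_prop)

/-- A point of the relative interior of the dual cone of `σ` is positive on each `v ∈ σ` that does
not vanish on the dual cone. -/
theorem dotProduct_pos_of_mem_intrinsicInterior {n : ℕ} {σ : PointedCone ℝ (Fin n → ℝ)}
    {x u v : Fin n → ℝ} (hx : x ∈ intrinsicInterior ℝ (dualCone σ : Set (Fin n → ℝ)))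
    (hv : v ∈ σ) (hu : u ∈ dualCone σ) (huv : 0 < v ⬝ᵥ u) : 0 < v ⬝ᵥ x := by
  obtain ⟨y, hy, rfl⟩ := mem_intrinsicInterior.1 hx
  -- Moving from x to x - εu stays in the span, hence in the dual cone for small ε > 0; this gives
  -- ⟨v,x⟩ ≥ ε⟨v,u⟩ > 0.
  have hmem : ∀ ε : ℝ, (y : Fin n → ℝ) - ε • u ∈ affineSpan ℝ (dualCone σ : Set (Fin n → ℝ)) := by
    intro ε
    have := (affineSpan ℝ (dualCone σ : Set (Fin n → ℝ))).smul_vsub_vadd_mem (-ε)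
      (subset_affineSpan ℝ _ hu)
      (subset_affineSpan ℝ _ (dualCone σ).zero_mem) y.2
    simpa [sub_eq_neg_add] using this
  have hc : Continuous fun ε : ℝ =>
      (⟨_, hmem ε⟩ : affineSpan ℝ (dualCone σ : Set (Fin n → ℝ))) :=
    Continuous.subtype_mk (by fun_prop) _
  have h0 : ∀ᶠ ε in 𝓝 (0 : ℝ), (⟨_, hmem ε⟩ : affineSpan ℝ (dualCone σ : Set (Fin n → ℝ))) ∈
      interior ((↑) ⁻¹' (dualCone σ : Set (Fin n → ℝ))) := by
    refine hc.continuousAt.eventually_mem (isOpen_interior.mem_nhds ?_)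
    simpa using hy
  obtain ⟨ε, hε, hε0⟩ := ((h0.filter_mono nhdsWithin_le_nhds).and
    (self_mem_nhdsWithin : Set.Ioi (0 : ℝ) ∈ 𝓝[>] 0)).exists
  have := mem_dualCone.1 (Set.mem_preimage.1 (interior_subset hε)) v hv
  rw [dotProduct_sub, dotProduct_smul, smul_eq_mul] at this
  have h2 : 0 < ε * (v ⬝ᵥ u) := mul_pos hε0 huv
  linarith

/-- The asymptotic cone of a set of lattice points that are bounded below on the generators of `σ`,
and none of which lies in the dual cone, is contained in the boundary of the dual cone. -/
theorem asymptoticCone_subset_boundary {n : ℕ} (S : Finset (Fin n → ℤ))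
    (hS : ∃ u : Fin n → ℤ, ∀ s ∈ S, 0 < s ⬝ᵥ u) (W : Set (Fin n → ℤ)) (C : ℤ)
    (hW : ∀ e ∈ W, (∀ s ∈ S, -C ≤ s ⬝ᵥ e) ∧ ∃ s ∈ S, s ⬝ᵥ e < 0) :
    asymptoticCone ℝ (toReal '' W) ⊆
      (dualCone (PointedCone.hull ℝ (toReal '' (S : Set (Fin n → ℤ)))) : Set (Fin n → ℝ)) \
        intrinsicInterior ℝ
          (dualCone (PointedCone.hull ℝ (toReal '' (S : Set (Fin n → ℤ)))) :
            Set (Fin n → ℝ)) := by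
  intro x hx
  -- In coordinates: there are pairs (r, y) with r arbitrarily large, y arbitrarily close to x, and
  -- ry in the given set.
  rw [mem_asymptoticCone_iff, AffineSpace.asymptoticNhds_eq_smul, ← map₂_smul,
    ← map_prod_eq_map₂, frequently_map] at hx
  have hcont : ∀ s : Fin n → ℤ, Tendsto (fun q : ℝ × (Fin n → ℝ) => toReal s ⬝ᵥ q.2)
      (atTop ×ˢ 𝓝 x) (𝓝 (toReal s ⬝ᵥ x)) := fun s =>
    ((by fun_prop : Continuous fun y : Fin n → ℝ => toReal s ⬝ᵥ y).tendsto x).comp tendsto_snd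
  have hval : ∀ (s e : Fin n → ℤ) (q : ℝ × (Fin n → ℝ)), toReal e = q.1 • q.2 →
      ((s ⬝ᵥ e : ℤ) : ℝ) = q.1 * (toReal s ⬝ᵥ q.2) := by
    intro s e q h
    rw [← toReal_dotProduct, h, dotProduct_smul, smul_eq_mul]
  have hnn : ∀ s ∈ S, 0 ≤ toReal s ⬝ᵥ x := by
    intro s hs
    by_contra! hlt
    have h1 : Tendsto (fun q : ℝ × (Fin n → ℝ) => q.1 * (toReal s ⬝ᵥ q.2)) (atTop ×ˢ 𝓝 x) atBot :=
      tendsto_fst.atTop_mul_neg hlt (hcont s)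
    obtain ⟨q, ⟨e, he, heq⟩, hq⟩ := (hx.and_eventually (h1.eventually_lt_atBot (-(C : ℝ)))).exists
    rw [← hval s e q heq] at hq
    have := (hW e he).1 s hs
    have h2 : s ⬝ᵥ e < -C := by exact_mod_cast hq
    omega
  -- If x were positive on all of `S`, so would be the nearby y, and ry would lie in the dual cone,
  -- which `hW` excludes.
  have hz : ∃ s ∈ S, toReal s ⬝ᵥ x ≤ 0 := by
    by_contra! hpos
    have h1 : ∀ᶠ q : ℝ × (Fin n → ℝ) in atTop ×ˢ 𝓝 x, ∀ s ∈ S, 0 < toReal s ⬝ᵥ q.2 :=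
      (Filter.eventually_all_finset S).2 fun s hs => (hcont s).eventually_const_lt (hpos s hs)
    obtain ⟨q, ⟨⟨e, he, heq⟩, hq⟩, hq0⟩ := ((hx.and_eventually h1).and_eventually
      (tendsto_fst.eventually_ge_atTop 0)).exists
    obtain ⟨s, hs, hlt⟩ := (hW e he).2
    have h2 : ((s ⬝ᵥ e : ℤ) : ℝ) < 0 := by exact_mod_cast hlt
    rw [hval s e q heq] at h2
    exact absurd (mul_nonneg hq0 (hq s hs).le) (not_le.2 h2)
  obtain ⟨s, hs, hsx⟩ := hz
  obtain ⟨u, hu⟩ := hS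
  refine ⟨(mem_dualCone_hull _ _).2 hnn, fun hint => hsx.not_gt ?_⟩
  refine dotProduct_pos_of_mem_intrinsicInterior (u := toReal u) hint
    (Submodule.subset_span ⟨s, hs, rfl⟩) ?_ ?_
  · exact mem_dualMonoid_hull.2 fun t ht => (hu t ht).le
  · rw [toReal_dotProduct]; exact_mod_cast hu s hs

theorem abs_dotProduct_fract_le {n : ℕ} (s : Fin n → ℤ) (y : Fin n → ℝ) :
    |toReal s ⬝ᵥ fun i => Int.fract (y i)| ≤ ∑ i, |(s i : ℝ)| := by
  refine (Finset.abs_sum_le_sum_abs _ _).trans (Finset.sum_le_sum fun i _ => ?_)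
  rw [abs_mul]
  refine mul_le_of_le_one_right (abs_nonneg _) ?_
  rw [abs_of_nonneg (Int.fract_nonneg _)]
  exact (Int.fract_lt_one _).le

/-- A point of the facet `σ^∨ ∩ s^⊥` of the dual cone is an asymptotic direction of the set of
lattice points `e` with `⟨s, e⟩ = -1` that are positive on the other generators. -/
theorem mem_asymptoticCone_demazure {n : ℕ} (S : Finset (Fin n → ℤ)) (s : Fin n → ℤ)
    (hf : ∃ f : Fin n → ℤ, s ⬝ᵥ f = 1)
    (hu : ∃ u : Fin n → ℤ, s ⬝ᵥ u = 0 ∧ ∀ s' ∈ S, s' ≠ s → 0 < s' ⬝ᵥ u)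
    {x : Fin n → ℝ} (hx : ∀ s' ∈ S, 0 ≤ toReal s' ⬝ᵥ x) (hsx : toReal s ⬝ᵥ x = 0) :
    x ∈ asymptoticCone ℝ (toReal ''
      {e : Fin n → ℤ | s ⬝ᵥ e = -1 ∧ ∀ s' ∈ S, s' ≠ s → 0 < s' ⬝ᵥ e}) := by
  obtain ⟨f, hf⟩ := hf
  obtain ⟨u, hu0, hu⟩ := hu
  let c : (Fin n → ℤ) → ℝ := fun t => ∑ i, |(t i : ℝ)|
  -- `K` exceeds, for every t in `S`, what rounding and the correction along `f` can take away from
  -- the pairing with t.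
  obtain ⟨K, hK⟩ := exists_nat_gt
    (∑ t ∈ S, (c t + c s * |((t ⬝ᵥ f : ℤ) : ℝ)| + |((t ⬝ᵥ f : ℤ) : ℝ)|))
  have hc : ∀ t, 0 ≤ c t := fun t => Finset.sum_nonneg fun i _ => abs_nonneg _
  have hK' : ∀ t ∈ S, c t + c s * |((t ⬝ᵥ f : ℤ) : ℝ)| + |((t ⬝ᵥ f : ℤ) : ℝ)| < K := by
    intro t ht
    refine lt_of_le_of_lt ?_ hK
    exact Finset.single_le_sum
      (f := fun t => c t + c s * |((t ⬝ᵥ f : ℤ) : ℝ)| + |((t ⬝ᵥ f : ℤ) : ℝ)|)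
      (fun t _ => add_nonneg (add_nonneg (hc t) (mul_nonneg (hc s) (abs_nonneg _)))
        (abs_nonneg _)) ht
  let fl : ℕ → Fin n → ℤ := fun j i => ⌊(j : ℝ) * x i⌋
  let fr : ℕ → Fin n → ℝ := fun j i => Int.fract ((j : ℝ) * x i)
  have hfl : ∀ j, toReal (fl j) = (j : ℝ) • x - fr j := by
    intro j
    ext i
    simp [toReal, fl, fr]
  -- Round jx down, use `f` to bring the pairing with `s` to exactly -1, and add `K • u`, which does
  -- not change that pairing but makes the others positive. The distance to jx stays bounded.
  let e : ℕ → Fin n → ℤ := fun j => K • u + fl j - (s ⬝ᵥ fl j + 1) • f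
  have hsfl : ∀ j, ((s ⬝ᵥ fl j : ℤ) : ℝ) = -(toReal s ⬝ᵥ fr j) := by
    intro j
    rw [← toReal_dotProduct, hfl, dotProduct_sub, dotProduct_smul, hsx]
    simp
  have he : ∀ j, toReal (e j) = (j : ℝ) • x + ((K : ℝ) • toReal u - fr j
      + (toReal s ⬝ᵥ fr j - 1) • toReal f) := by
    intro j
    have : e j = K • u + fl j + -((s ⬝ᵥ fl j + 1) • f) := sub_eq_add_neg _ _
    rw [this, toReal_add, toReal_add, toReal_neg, toReal_nsmul, toReal_zsmul, hfl]
    push_cast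
    rw [hsfl]
    module
  have hemem : ∀ j, e j ∈ {e : Fin n → ℤ | s ⬝ᵥ e = -1 ∧ ∀ s' ∈ S, s' ≠ s → 0 < s' ⬝ᵥ e} := by
    intro j
    constructor
    · simp only [e, dotProduct_sub, dotProduct_add, dotProduct_smul, hu0, hf, smul_eq_mul]
      simp
    · intro t ht hts
      have h1 : (0 : ℝ) < ((t ⬝ᵥ e j : ℤ) : ℝ) := by
        rw [← toReal_dotProduct, he]
        simp only [dotProduct_sub, dotProduct_add, dotProduct_smul, smul_eq_mul]
        rw [toReal_dotProduct t u, toReal_dotProduct t f]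
        have h2 : (1 : ℝ) ≤ ((t ⬝ᵥ u : ℤ) : ℝ) := by exact_mod_cast hu t ht hts
        have h3 := abs_le.1 (abs_dotProduct_fract_le t fun i => (j : ℝ) * x i)
        have h4 := abs_dotProduct_fract_le s fun i => (j : ℝ) * x i
        have h5 := hx t ht
        have h6 := hK' t ht
        have h7 : -(c s * |((t ⬝ᵥ f : ℤ) : ℝ)|) ≤ (toReal s ⬝ᵥ fr j) * ((t ⬝ᵥ f : ℤ) : ℝ) := by
          refine (neg_le_neg ?_).trans (neg_abs_le _)
          rw [abs_mul]
          exact mul_le_mul_of_nonneg_right h4 (abs_nonneg _)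
        have h8 := le_abs_self ((t ⬝ᵥ f : ℤ) : ℝ)
        have h9 : (0 : ℝ) ≤ (j : ℝ) * (toReal t ⬝ᵥ x) := by positivity
        have h10 : (K : ℝ) ≤ K * ((t ⬝ᵥ u : ℤ) : ℝ) := le_mul_of_one_le_right (by positivity) h2
        have h11 := h3.2
        change toReal t ⬝ᵥ fr j ≤ c t at h11
        linarith
      exact_mod_cast h1
  have hlim : Tendsto (fun j : ℕ => (j : ℝ)⁻¹ • toReal (e j)) atTop (𝓝 x) := by
    have hinv : Tendsto (fun j : ℕ => (j : ℝ)⁻¹) atTop (𝓝 0) := tendsto_inv_atTop_nhds_zero_nat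
    have hfr : ∀ y : Fin n → ℝ, Tendsto (fun j : ℕ => (j : ℝ)⁻¹ * (y ⬝ᵥ fr j)) atTop (𝓝 0) := by
      intro y
      refine Tendsto.zero_mul_isBoundedUnder_le hinv ?_
      refine isBoundedUnder_of ⟨∑ i, |y i|, fun j => ?_⟩
      refine (Finset.abs_sum_le_sum_abs _ _).trans (Finset.sum_le_sum fun i _ => ?_)
      rw [abs_mul]
      refine mul_le_of_le_one_right (abs_nonneg _) ?_
      rw [abs_of_nonneg (Int.fract_nonneg _)]
      exact (Int.fract_lt_one _).le
    have hrest : Tendsto (fun j : ℕ => x + ((j : ℝ)⁻¹ • ((K : ℝ) • toReal u - toReal f)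
        - (j : ℝ)⁻¹ • fr j + ((j : ℝ)⁻¹ * (toReal s ⬝ᵥ fr j)) • toReal f)) atTop
        (𝓝 (x + ((0 : ℝ) • ((K : ℝ) • toReal u - toReal f) - 0 + (0 : ℝ) • toReal f))) := by
      refine tendsto_const_nhds.add (((hinv.smul_const _).sub ?_).add ((hfr _).smul_const _))
      rw [tendsto_pi_nhds]
      intro i
      simpa using hfr (Pi.single i 1)
    have : x + ((0 : ℝ) • ((K : ℝ) • toReal u - toReal f) - 0 + (0 : ℝ) • toReal f) = x := by simp
    rw [this] at hrest
    refine hrest.congr' ?_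
    filter_upwards [eventually_gt_atTop 0] with j hj
    have hj' : (j : ℝ) ≠ 0 := by exact_mod_cast hj.ne'
    rw [he, smul_add, smul_smul, inv_mul_cancel₀ hj', one_smul]
    module
  rw [mem_asymptoticCone_iff]
  have ht := (tendsto_natCast_atTop_atTop (R := ℝ)).atTop_smul_nhds_tendsto_asymptoticNhds hlim
  refine ht.frequently (Eventually.frequently ?_)
  filter_upwards [eventually_gt_atTop 0] with j hj
  have hj' : (j : ℝ) ≠ 0 := by exact_mod_cast hj.ne'
  rw [smul_smul, mul_inv_cancel₀ hj', one_smul]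
  exact ⟨e j, hemem j, rfl⟩

end Cones

/-! ### Homogeneous derivations of the coordinate ring -/

section Derivations

variable {k : Type u} [Field k] {n : ℕ} {σ : PointedCone ℝ (Fin n → ℝ)}

/-- Inherited from ℤⁿ; it is what makes k[σ^∨_M] a domain. -/
instance uniqueSums_dualMonoid (σ : PointedCone ℝ (Fin n → ℝ)) : UniqueSums (dualMonoid σ) :=
  UniqueSums.of_injective_addHom (G := Fin n → ℤ) ((dualMonoid σ).subtype : _ →ₙ+ _)
    Subtype.val_injective inferInstance

instance isDomain_coordRing : IsDomain (coordRing k σ) :=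
  inferInstanceAs (IsDomain (AddMonoidAlgebra k (dualMonoid σ)))

instance charZero_coordRing [CharZero k] : CharZero (coordRing k σ) :=
  charZero_of_injective_algebraMap (algebraMap k (coordRing k σ)).injective

variable (k) in
/-- The character `χ^m` as an element of the coordinate ring. -/
def chi (m : dualMonoid σ) : coordRing k σ := AddMonoidAlgebra.single m 1

theorem chi_zero : chi k (0 : dualMonoid σ) = 1 := rfl

theorem chi_mul (a b : dualMonoid σ) : chi k a * chi k b = chi k (a + b) := by
  rw [chi, chi, AddMonoidAlgebra.single_mul_single, mul_one, chi]

theorem chi_ne_zero (m : dualMonoid σ) : chi k m ≠ 0 := by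
  simp [chi]

theorem chi_pow (m : dualMonoid σ) (N : ℕ) : chi k m ^ N = chi k (N • m) := by
  simp [chi, AddMonoidAlgebra.single_pow]

theorem smul_chi (c : k) (m : dualMonoid σ) : c • chi k m = AddMonoidAlgebra.single m c := by
  simp [chi]

theorem torusOnFunctions_chi (t : Fin n → kˣ) (m : dualMonoid σ) :
    torusOnFunctions σ t (chi k m) = (character (m : Fin n → ℤ) t : k) • chi k m := by
  rw [chi, torusOnFunctions_single, one_mul, ← smul_chi, chi]

theorem coeff_torusOnFunctions (t : Fin n → kˣ) (f : coordRing k σ) (q : dualMonoid σ) :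
    (torusOnFunctions σ t f).coeff q = f.coeff q * character (q : Fin n → ℤ) t := by
  induction f using AddMonoidAlgebra.induction_linear with
  | zero => simp
  | add f g hf hg => simp [map_add, hf, hg, add_mul]
  | single m c =>
    classical
    rw [torusOnFunctions_single, AddMonoidAlgebra.coeff_single, AddMonoidAlgebra.coeff_single,
      Finsupp.single_apply, Finsupp.single_apply]
    split_ifs with h
    · rw [h]
    · simp

theorem character_add (a b : Fin n → ℤ) (t : Fin n → kˣ) :
    character (a + b) t = character a t * character b t := by
  simp [character, zpow_add, Finset.prod_mul_distrib]

theorem character_inv (a : Fin n → ℤ) (t : Fin n → kˣ) :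
    character a t⁻¹ = (character a t)⁻¹ := by
  simp [character]

theorem character_nsmul (N : ℕ) (a : Fin n → ℤ) (t : Fin n → kˣ) :
    character (N • a) t = character a t ^ N := by
  simp [character, Finset.prod_pow, zpow_mul, mul_comm (N : ℤ)]

/-- Distinct characters of the torus are distinct as functions on `k`-points. -/
theorem exists_character_ne [CharZero k] {a b : Fin n → ℤ} (h : a ≠ b) :
    ∃ t : Fin n → kˣ, character a t ≠ character b t := by
  obtain ⟨i, hi⟩ := Function.ne_iff.1 h
  -- Put 2 in a coordinate where the exponents differ; distinct powers of 2 stay distinct in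
  -- characteristic zero.
  refine ⟨Pi.mulSingle i (Units.mk0 2 two_ne_zero), fun heq => hi ?_⟩
  have hval : ∀ c : Fin n → ℤ,
      ((character c (Pi.mulSingle i (Units.mk0 (2 : k) two_ne_zero)) : kˣ) : k) =
        (((2 : ℚ) ^ c i : ℚ) : k) := by
    intro c
    rw [character, Finset.prod_eq_single i]
    · simp
    · intro j _ hj
      simp [Pi.mulSingle_eq_of_ne hj]
    · simp
  have h1 := congrArg (Units.val : kˣ → k) heq
  rw [hval, hval, Rat.cast_inj] at h1
  exact zpow_right_injective₀ (by norm_num) (by norm_num) h1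

/-- A `k`-derivation of `k[σ^∨_M]` that is homogeneous of degree `e`. -/
def IsHomogeneousDerivation (D : Derivation k (coordRing k σ) (coordRing k σ))
    (e : Fin n → ℤ) : Prop :=
  ∀ (m : dualMonoid σ) (q : dualMonoid σ), (D (chi k m)).coeff q ≠ 0 → (q : Fin n → ℤ) = m + e

theorem IsHomogeneousDerivation.add_mem {D : Derivation k (coordRing k σ) (coordRing k σ)}
    {e : Fin n → ℤ} (hD : IsHomogeneousDerivation D e) {m : dualMonoid σ}
    (hm : D (chi k m) ≠ 0) : (m : Fin n → ℤ) + e ∈ dualMonoid σ := by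
  have : ∃ q, (D (chi k m)).coeff q ≠ 0 := by
    by_contra! h
    exact hm (AddMonoidAlgebra.ext (Finsupp.ext h))
  obtain ⟨q, hq⟩ := this
  rw [← hD m q hq]
  exact q.2

theorem exists_chi_ne_zero {D : Derivation k (coordRing k σ) (coordRing k σ)} (hD : D ≠ 0) :
    ∃ m, D (chi k m) ≠ 0 := by
  by_contra! h
  refine hD (Derivation.ext fun f => ?_)
  induction f using AddMonoidAlgebra.induction_linear with
  | zero => simp
  | add f g hf hg => rw [map_add, hf, hg, map_add]
  | single m c => rw [← smul_chi, D.map_smul, h m]; simp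

/-- The degree of a nonzero homogeneous locally nilpotent derivation of `k[σ^∨_M]` does not lie in
`σ^∨`. -/
theorem notMem_dualMonoid_of_locallyNilpotent [CharZero k]
    {D : Derivation k (coordRing k σ) (coordRing k σ)} {e : Fin n → ℤ}
    (hD : IsHomogeneousDerivation D e) (h0 : D ≠ 0) (hnil : ∀ f, ∃ N : ℕ, D^[N] f = 0) :
    e ∉ dualMonoid σ := by
  intro he
  let e' : dualMonoid σ := ⟨e, he⟩
  let l : dualMonoid σ → k := fun m => (D (chi k m)).coeff (m + e')
  have hl : ∀ m, D (chi k m) = l m • chi k (m + e') := by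
    intro m
    rw [smul_chi]
    refine AddMonoidAlgebra.ext (Finsupp.ext fun q => ?_)
    classical
    rw [AddMonoidAlgebra.coeff_single, Finsupp.single_apply]
    split_ifs with h
    · rw [← h]
    · by_contra hq
      exact h (Subtype.ext (hD m q hq).symm)
  have hladd : ∀ a b, l (a + b) = l a + l b := by
    intro a b
    have h1 : D (chi k (a + b)) = chi k a • D (chi k b) + chi k b • D (chi k a) := by
      rw [← chi_mul, D.leibniz]
    rw [hl, hl, hl, smul_eq_mul, smul_eq_mul, mul_smul_comm, mul_smul_comm, chi_mul, chi_mul,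
      ← add_assoc, ← add_assoc, add_comm b a, ← add_smul, ← sub_eq_zero, ← sub_smul] at h1
    rcases smul_eq_zero.1 h1 with h2 | h2
    · rw [sub_eq_zero.1 h2, add_comm]
    · exact absurd h2 (chi_ne_zero _)
  have hlz : l 0 = 0 := by simpa using hladd 0 0
  have hlN : ∀ m (N : ℕ), l (m + N • e') = l m + N * l e' := by
    intro m N
    induction N with
    | zero => simp
    | succ N ih => rw [succ_nsmul, ← add_assoc, hladd, ih]; push_cast; ring
  have hiter : ∀ m (N : ℕ), D^[N] (chi k m) =
      (∏ i ∈ Finset.range N, (l m + i * l e')) • chi k (m + N • e') := by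
    intro m N
    induction N with
    | zero => simp
    | succ N ih =>
      rw [Function.iterate_succ_apply', ih, D.map_smul, hl, smul_smul, hlN, Finset.prod_range_succ,
        succ_nsmul, ← add_assoc]
  -- If l(e) = 0, any m with l(m) ≠ 0 works; otherwise m = e does, with factors (i + 1) l(e),
  -- nonzero in characteristic zero.
  obtain ⟨m, hm⟩ : ∃ m, ∀ i : ℕ, l m + i * l e' ≠ 0 := by
    by_cases hle : l e' = 0
    · obtain ⟨m, hm⟩ := exists_chi_ne_zero h0
      refine ⟨m, fun i h => hm ?_⟩
      rw [hle, mul_zero, add_zero] at h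
      rw [hl, h, zero_smul]
    · refine ⟨e', fun i h => hle ?_⟩
      have h1 : ((i + 1 : ℕ) : k) * l e' = 0 := by push_cast; linear_combination h
      exact (mul_eq_zero.1 h1).resolve_left (by exact_mod_cast i.succ_ne_zero)
  obtain ⟨N, hN⟩ := hnil (chi k m)
  rw [hiter] at hN
  rcases smul_eq_zero.1 hN with h | h
  · obtain ⟨i, -, hi⟩ := Finset.prod_eq_zero_iff.1 h
    exact hm i hi
  · exact chi_ne_zero _ h

/-- The degrees of the nonzero homogeneous derivations of `k[σ^∨_M]` are uniformly bounded below on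
the generators of `σ`. -/
theorem exists_bound_of_derivation (k : Type u) [Field k] (S : Finset (Fin n → ℤ))
    (hS : ∃ u : Fin n → ℤ, ∀ s ∈ S, 0 < s ⬝ᵥ u)
    (hσ : σ = PointedCone.hull ℝ (toReal '' (S : Set (Fin n → ℤ)))) :
    ∃ C : ℤ, ∀ (D : Derivation k (coordRing k σ) (coordRing k σ)) (e : Fin n → ℤ),
      IsHomogeneousDerivation D e → D ≠ 0 → ∀ s ∈ S, -C ≤ s ⬝ᵥ e := by
  classical
  have hmem : ∀ m : Fin n → ℤ, m ∈ dualMonoid σ ↔ ∀ s ∈ S, 0 ≤ s ⬝ᵥ m := by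
    intro m; rw [hσ, mem_dualMonoid_hull]; rfl
  obtain ⟨u, hu⟩ := hS
  -- `K` bounds all coordinates of all generators, so a `v` with ⟨s,v⟩ ≥ `K` remains in σ^∨ when a
  -- unit vector is added or subtracted. The test characters are `v` and these neighbours.
  let K : ℤ := ∑ s ∈ S, ∑ i, |s i|
  have hK : ∀ s ∈ S, ∀ i, |s i| ≤ K := fun s hs i =>
    (Finset.single_le_sum (f := fun i => |s i|) (fun _ _ => abs_nonneg _) (Finset.mem_univ i)).trans
      (Finset.single_le_sum (f := fun s : Fin n → ℤ => ∑ i, |s i|)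
        (fun _ _ => Finset.sum_nonneg fun _ _ => abs_nonneg _) hs)
  have hK0 : 0 ≤ K := Finset.sum_nonneg fun _ _ => Finset.sum_nonneg fun _ _ => abs_nonneg _
  let v : Fin n → ℤ := K • u
  have hv : ∀ s ∈ S, K ≤ s ⬝ᵥ v := by
    intro s hs
    have := hu s hs
    rw [dotProduct_smul, smul_eq_mul]
    nlinarith
  have hsingle : ∀ (s : Fin n → ℤ) (i : Fin n) (c : ℤ), s ⬝ᵥ Pi.single i c = s i * c := by
    intro s i c; simp
  have hvmem : v ∈ dualMonoid σ := (hmem v).2 fun s hs => hK0.trans (hv s hs)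
  have hvi : ∀ (i : Fin n) (c : ℤ), |c| ≤ 1 → v + Pi.single i c ∈ dualMonoid σ := by
    intro i c hc
    refine (hmem _).2 fun s hs => ?_
    rw [dotProduct_add, hsingle]
    have h1 := (neg_abs_le (s i * c))
    rw [abs_mul] at h1
    have h2 := hK s hs i
    have h3 := hv s hs
    have h4 := mul_le_of_le_one_right (abs_nonneg (s i)) hc
    linarith
  -- Each test exponent m satisfies ⟨s,m⟩ ≤ ⟨s,v⟩ + K ≤ 2⟨s,v⟩, and m + e ∈ σ^∨ as soon as D χ^m ≠
  -- 0.
  refine ⟨2 * ∑ s ∈ S, s ⬝ᵥ v, fun D e hD h0 s hs => ?_⟩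
  have hsv : s ⬝ᵥ v ≤ ∑ s ∈ S, s ⬝ᵥ v :=
    Finset.single_le_sum (f := fun s : Fin n → ℤ => s ⬝ᵥ v)
      (fun t ht => hK0.trans (hv t ht)) hs
  by_cases hz : D (chi k ⟨v, hvmem⟩) = 0 ∧
      ∀ (i : Fin n) (c : ℤ) (hc : |c| ≤ 1), D (chi k ⟨_, hvi i c hc⟩) = 0
  · exfalso
    -- If `D` kills all test characters, the w for which some χ^{Nv+w} is killed form a submonoid by
    -- Leibniz. It contains all ± unit vectors, so it is ℤⁿ. Cancelling χ^{Nv} in the domain then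
    -- gives `D` = 0.
    let H : AddSubmonoid (Fin n → ℤ) :=
      { carrier := {w | ∃ (N : ℕ) (h : N • v + w ∈ dualMonoid σ), D (chi k ⟨_, h⟩) = 0}
        zero_mem' := ⟨0, by simp, by
          have : (⟨0 • v + 0, by simp⟩ : dualMonoid σ) = 0 := Subtype.ext (by simp)
          rw [this, chi_zero]; simp⟩
        add_mem' := by
          rintro a b ⟨N, hN, hN0⟩ ⟨N', hN', hN0'⟩
          have heq : (N + N') • v + (a + b) = (N • v + a) + (N' • v + b) := by
            rw [add_nsmul]; abel
          refine ⟨N + N', heq ▸ (dualMonoid σ).add_mem hN hN', ?_⟩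
          have : (⟨_, heq ▸ (dualMonoid σ).add_mem hN hN'⟩ : dualMonoid σ) =
            ⟨_, hN⟩ + ⟨_, hN'⟩ := Subtype.ext heq
          rw [this, ← chi_mul, D.leibniz, hN0, hN0']
          simp }
    have hH1 : ∀ (i : Fin n) (c : ℤ), |c| ≤ 1 → Pi.single i c ∈ H := by
      intro i c hc
      refine ⟨1, by rw [one_nsmul]; exact hvi i c hc, ?_⟩
      simp_rw [one_nsmul]
      exact hz.2 i c hc
    have hH : ∀ w, w ∈ H := by
      intro w
      rw [← Finset.univ_sum_single w]
      refine H.sum_mem fun i _ => ?_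
      obtain ⟨N, h | h⟩ := Int.eq_nat_or_neg (w i)
      · have : Pi.single i (w i) = N • (Pi.single i 1 : Fin n → ℤ) := by
          rw [h, ← Pi.single_smul]; simp
        rw [this]
        exact H.nsmul_mem (hH1 i 1 (by simp)) N
      · have : Pi.single i (w i) = N • (Pi.single i (-1) : Fin n → ℤ) := by
          rw [h, ← Pi.single_smul]; simp
        rw [this]
        exact H.nsmul_mem (hH1 i (-1) (by simp)) N
    obtain ⟨m, hm⟩ := exists_chi_ne_zero h0
    obtain ⟨N, hN, hN0⟩ := hH m
    have heq : (⟨_, hN⟩ : dualMonoid σ) = N • ⟨v, hvmem⟩ + m := rfl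
    rw [heq, ← chi_mul, D.leibniz, ← chi_pow, D.leibniz_pow, hz.1] at hN0
    rw [smul_zero, smul_zero, smul_zero, add_zero, smul_eq_mul] at hN0
    exact (mul_eq_zero.1 hN0).elim (pow_ne_zero N (chi_ne_zero _)) hm
  · rw [not_and_or] at hz
    rcases hz with hz | hz
    · have := (hmem _).1 (hD.add_mem hz) s hs
      have h2 := hv s hs
      simp only [dotProduct_add] at this
      linarith
    · push Not at hz
      obtain ⟨i, c, hc, hz⟩ := hz
      have := (hmem _).1 (hD.add_mem hz) s hs
      simp only [dotProduct_add, hsingle] at this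
      have h1 := (le_abs_self (s i * c))
      rw [abs_mul] at h1
      have h2 := hK s hs i
      have h3 := hv s hs
      have h4 := mul_le_of_le_one_right (abs_nonneg (s i)) hc
      linarith

end Derivations

/-! ### From additive coactions to locally nilpotent derivations -/

section Coactions

open Polynomial

variable {k R : Type*} [Field k] [CommRing R] [Algebra k R]

/-- The derivation given by the linear coefficients of a homomorphism `R → R[X]` which reduces to
the identity modulo `X`. -/
def coactionDerivation (E : R →ₐ[k] R[X]) (h0 : ∀ r, (E r).coeff 0 = r) : Derivation k R R :=
  Derivation.mk'
    { toFun := fun r => (E r).coeff 1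
      map_add' := by simp
      map_smul' := by simp }
    (fun a b => by
      simp only [LinearMap.coe_mk, AddHom.coe_mk, map_mul, mul_coeff_one, h0, smul_eq_mul]
      ring)

/-- The coaction `E : R → R[X]` is additive in `X`, at the constants of `k`. -/
def IsAdditiveCoaction (E : R →ₐ[k] R[X]) : Prop :=
  ∀ (c : k) (r : R), (E r).eval₂ C (X + C (algebraMap k R c)) =
    (E r).eval₂ ((eval₂RingHom C (C (algebraMap k R c))).comp (E : R →+* R[X])) X

variable [CharZero k] [IsDomain R] (E : R →ₐ[k] R[X]) (h0 : ∀ r, (E r).coeff 0 = r)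

/-- Compare the coefficients of `X` in the additivity relation at a constant c: the Taylor expansion
of `E r` at c gives its derivative at c, the other side gives the value of `E (D r)` at c.
Infinitely many c in a domain determine the polynomial. -/
theorem derivative_coaction (hadd : IsAdditiveCoaction E) (r : R) :
    derivative (E r) = E (coactionDerivation E h0 r) := by
  apply eq_of_infinite_eval_eq
  refine Set.Infinite.mono ?_ (Set.infinite_range_of_injective (algebraMap k R).injective)
  rintro _ ⟨c, rfl⟩
  have hC : (eval₂RingHom C (C (algebraMap k R c))).comp (E : R →+* R[X]) =
      C.comp ((evalRingHom (algebraMap k R c)).comp (E : R →+* R[X])) := by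
    ext1 r
    simp only [RingHom.comp_apply, coe_eval₂RingHom, coe_evalRingHom]
    exact eval₂_at_apply C _
  have h := congrArg (fun p => coeff p 1) (hadd c r)
  simp only [hC] at h
  rw [show eval₂ C (X + C (algebraMap k R c)) (E r) = taylor (algebraMap k R c) (E r) from rfl,
    taylor_coeff_one] at h
  change Polynomial.eval _ _ = Polynomial.coeff (Polynomial.map _ (E r)) 1 at h
  rw [coeff_map] at h
  exact h

/-- `E` intertwines the derivation with d/dX, which is nilpotent on each polynomial; constant terms
recover the iterates. -/
theorem iterate_coactionDerivation_eq_zero (hadd : IsAdditiveCoaction E) (r : R) :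
    ∃ N : ℕ, (coactionDerivation E h0)^[N] r = 0 := by
  have h : ∀ N : ℕ, derivative^[N] (E r) = E ((coactionDerivation E h0)^[N] r) := by
    intro N
    induction N with
    | zero => rfl
    | succ N ih =>
      rw [Function.iterate_succ_apply', ih, derivative_coaction E h0 hadd,
        Function.iterate_succ_apply']
  refine ⟨(E r).natDegree + 1, ?_⟩
  rw [← h0 ((coactionDerivation E h0)^[_] r), ← h, iterate_derivative_eq_zero (Nat.lt_succ_self _),
    coeff_zero]

theorem coactionDerivation_ne_zero (hadd : IsAdditiveCoaction E) (hE : ∃ r, E r ≠ C r) :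
    coactionDerivation E h0 ≠ 0 := by
  intro hD
  obtain ⟨r, hr⟩ := hE
  have : CharZero R := charZero_of_injective_algebraMap (algebraMap k R).injective
  have h := derivative_coaction E h0 hadd r
  rw [hD, Derivation.coe_zero, Pi.zero_apply, map_zero, derivative_eq_zero] at h
  rw [eq_C_of_natDegree_eq_zero h, h0] at hr
  exact hr rfl

end Coactions

/-! ### The coaction of a Demazure root -/

section DemazureCoaction

open Polynomial

/-- Apply the linear functional X^q ↦ c q to (aX + (bX + 1))^d = ((a + b)X + 1)^d, expanded in both
ways. With c q the value of χ^{m+qe}, this is the additivity of the Demazure coaction, without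
treating χ^e itself as a function. -/
theorem sum_choose_add_pow {B : Type*} [CommRing B] (c : ℕ → B) (a b : B) (d : ℕ) :
    ∑ q ∈ Finset.range (d + 1), (d.choose q : B) * c q * (a + b) ^ q =
      ∑ i ∈ Finset.range (d + 1), (d.choose i : B) * a ^ i *
        ∑ l ∈ Finset.range (d - i + 1), ((d - i).choose l : B) * c (i + l) * b ^ l := by
  let φ : B[X] →ₗ[B] B := lsum fun q => LinearMap.mulRight B (c q)
  have hφ : ∀ (x : B) (q : ℕ), φ (C x * X ^ q) = x * c q := by
    intro x q
    simp [φ, C_mul_X_pow_eq_monomial, lsum_apply]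
  have h1 : ((C a * X) + (C b * X + 1)) ^ d = ((C (a + b) * X) + 1 : B[X]) ^ d := by
    congr 1; rw [C_add]; ring
  have h2 := congrArg φ h1
  rw [add_pow, add_pow, map_sum, map_sum] at h2
  rw [← Finset.sum_congr rfl fun q _ => ?_, ← h2, ← Finset.sum_congr rfl fun i _ => ?_]
  · rw [add_pow, Finset.mul_sum, Finset.mul_sum, Finset.sum_mul, map_sum]
    refine Finset.sum_congr rfl fun l _ => ?_
    have : (C a * X) ^ i * ((C b * X) ^ l * 1 ^ (d - i - l) * ((d - i).choose l : B[X]))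
        * (d.choose i : B[X]) =
        C (a ^ i * b ^ l * ((d - i).choose l : B) * (d.choose i : B)) * X ^ (i + l) := by
      simp only [map_mul, map_pow, map_natCast, one_pow]
      ring
    rw [this, hφ]
    ring
  · have : (C (a + b) * X) ^ q * 1 ^ (d - q) * (d.choose q : B[X]) =
        C ((a + b) ^ q * (d.choose q : B)) * X ^ q := by
      simp only [map_mul, map_pow, map_natCast, one_pow]
      ring
    rw [this, hφ]
    ring

variable {k : Type u} [Field k] {n : ℕ} {σ : PointedCone ℝ (Fin n → ℝ)}

/-- A lattice vector `e` is a Demazure root of `σ` with respect to the lattice vector `s ∈ σ`. -/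
structure IsDemazureRoot (σ : PointedCone ℝ (Fin n → ℝ)) (s e : Fin n → ℤ) : Prop where
  nonneg : ∀ m ∈ dualMonoid σ, 0 ≤ s ⬝ᵥ m
  eq_neg_one : s ⬝ᵥ e = -1
  add_mem : ∀ m ∈ dualMonoid σ, 0 < s ⬝ᵥ m → m + e ∈ dualMonoid σ

/-- Each step lowers the pairing with `s` by one, so it stays positive before the last permitted
step. Hence `demazurePoly` of an `m` in the monoid never uses the default value of `chiOrZero`. -/
theorem IsDemazureRoot.add_nsmul_mem {s e : Fin n → ℤ} (h : IsDemazureRoot σ s e)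
    {m : Fin n → ℤ} (hm : m ∈ dualMonoid σ) {i : ℕ} (hi : i ≤ (s ⬝ᵥ m).toNat) :
    m + i • e ∈ dualMonoid σ := by
  induction i with
  | zero => simpa using hm
  | succ i ih =>
    rw [succ_nsmul, ← add_assoc]
    refine h.add_mem _ (ih (by omega)) ?_
    rw [dotProduct_add, dotProduct_smul, h.eq_neg_one, nsmul_eq_mul]
    omega

variable (k) in
/-- The function `χ^m` if `m ∈ σ^∨_M`, and zero otherwise. -/
def chiOrZero (σ : PointedCone ℝ (Fin n → ℝ)) (m : Fin n → ℤ) : coordRing k σ :=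
  open Classical in if h : m ∈ dualMonoid σ then chi k ⟨m, h⟩ else 0

theorem chiOrZero_of_mem {m : Fin n → ℤ} (h : m ∈ dualMonoid σ) :
    chiOrZero k σ m = chi k ⟨m, h⟩ := dif_pos h

variable (k) in
/-- The polynomial `∑ᵢ (⟨m,s⟩ choose i) χ^{m+ie} tⁱ`, formally `χ^m (1 + χ^e t)^⟨m,s⟩`. -/
def demazurePoly (σ : PointedCone ℝ (Fin n → ℝ)) (s e m : Fin n → ℤ) : (coordRing k σ)[X] :=
  ∑ i ∈ Finset.range ((s ⬝ᵥ m).toNat + 1),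
    C (((s ⬝ᵥ m).toNat.choose i : coordRing k σ) * chiOrZero k σ (m + i • e)) * X ^ i

theorem demazurePoly_zero (s e : Fin n → ℤ) : demazurePoly k σ s e 0 = 1 := by
  have : chiOrZero k σ (0 : Fin n → ℤ) = 1 := chiOrZero_of_mem (dualMonoid σ).zero_mem
  simp [demazurePoly, this]

/-- In k[M], where χ^e exists, the polynomial is χ^m (1 + χ^e t)^⟨s,m⟩ and the claim is evident;
k[σ^∨_M] embeds there. -/
theorem demazurePoly_mul {s e : Fin n → ℤ} (h : IsDemazureRoot σ s e) {a b : Fin n → ℤ}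
    (ha : a ∈ dualMonoid σ) (hb : b ∈ dualMonoid σ) :
    demazurePoly k σ s e a * demazurePoly k σ s e b = demazurePoly k σ s e (a + b) := by
  let ι := inclHom k (le_top : dualMonoid σ ≤ ⊤)
  let y : (Fin n → ℤ) → AddMonoidAlgebra k (⊤ : AddSubmonoid (Fin n → ℤ)) :=
    fun m => AddMonoidAlgebra.single ⟨m, trivial⟩ 1
  have hy : ∀ a b, y (a + b) = y a * y b := by
    intro a b
    simp only [y, AddMonoidAlgebra.single_mul_single, mul_one]
    rfl
  have hyn : ∀ a (i : ℕ), y (i • a) = y a ^ i := by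
    intro a i
    simp only [y, AddMonoidAlgebra.single_pow, one_pow]
    rfl
  have key : ∀ m ∈ dualMonoid σ, (demazurePoly k σ s e m).map ι =
      C (y m) * (C (y e) * X + 1) ^ (s ⬝ᵥ m).toNat := by
    intro m hm
    rw [demazurePoly, Polynomial.map_sum, add_pow, Finset.mul_sum]
    refine Finset.sum_congr rfl fun i hi => ?_
    rw [chiOrZero_of_mem (h.add_nsmul_mem hm (Nat.lt_succ_iff.1 (Finset.mem_range.1 hi)))]
    have h1 : ι (chi k ⟨_, h.add_nsmul_mem hm (Nat.lt_succ_iff.1 (Finset.mem_range.1 hi))⟩) =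
        y m * y e ^ i := by
      rw [← hyn, ← hy]
      exact inclHom_single k _ _ _
    simp only [Polynomial.map_mul, map_C, map_mul, h1, map_natCast, Polynomial.map_natCast,
      map_pow, Polynomial.map_pow, map_X, one_pow]
    ring
  apply Polynomial.map_injective ι (inclHom_injective k _)
  rw [Polynomial.map_mul, key a ha, key b hb, key _ ((dualMonoid σ).add_mem ha hb), hy,
    dotProduct_add, Int.toNat_add (h.nonneg a ha) (h.nonneg b hb), pow_add, C_mul]
  ring

variable (k) in
/-- The coaction `χ^m ↦ χ^m (1 + χ^e t)^⟨m,s⟩` of the additive group on `k[σ^∨_M]` defined by a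
Demazure root `e`. -/
def demazureCoaction {s e : Fin n → ℤ} (h : IsDemazureRoot σ s e) :
    coordRing k σ →ₐ[k] (coordRing k σ)[X] :=
  AddMonoidAlgebra.lift k (coordRing k σ)[X] (dualMonoid σ)
    { toFun := fun m => demazurePoly k σ s e (m.toAdd : Fin n → ℤ)
      map_one' := demazurePoly_zero s e
      map_mul' := fun a b => (demazurePoly_mul h a.toAdd.2 b.toAdd.2).symm }

theorem demazureCoaction_chi {s e : Fin n → ℤ} (h : IsDemazureRoot σ s e) (m : dualMonoid σ) :
    demazureCoaction k h (chi k m) = demazurePoly k σ s e m := by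
  rw [demazureCoaction, chi, AddMonoidAlgebra.lift_single, one_smul]
  rfl

theorem torusOnFunctions_chi_mul (t : Fin n → kˣ) (m : dualMonoid σ) :
    torusOnFunctions σ t (chi k m) =
      algebraMap k (coordRing k σ) (character (m : Fin n → ℤ) t : k) * chi k m := by
  rw [torusOnFunctions_chi, Algebra.smul_def]

theorem eval₂_demazurePoly {B : Type*} [CommRing B] (ξ : coordRing k σ →+* B) (a : B)
    (s e m : Fin n → ℤ) : (demazurePoly k σ s e m).eval₂ ξ a =
      ∑ i ∈ Finset.range ((s ⬝ᵥ m).toNat + 1),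
        ((s ⬝ᵥ m).toNat.choose i : B) * ξ (chiOrZero k σ (m + i • e)) * a ^ i := by
  simp [demazurePoly, eval₂_finsetSum]

/-- Two ring homomorphisms out of `k[σ^∨_M]` agree if they do so on constants and characters. -/
theorem ringHom_coordRing_ext {B : Type*} [CommRing B] {f g : coordRing k σ →+* B}
    (h1 : ∀ c : k, f (algebraMap k _ c) = g (algebraMap k _ c))
    (h2 : ∀ m, f (chi k m) = g (chi k m)) : f = g :=
  AddMonoidAlgebra.ringHom_ext h1 h2

theorem eval₂_zero_demazureCoaction {s e : Fin n → ℤ} (h : IsDemazureRoot σ s e) {B : Type*}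
    [CommRing B] (ξ : coordRing k σ →+* B) (r : coordRing k σ) :
    (demazureCoaction k h r).eval₂ ξ 0 = ξ r := by
  have : (eval₂RingHom ξ 0).comp (demazureCoaction k h : coordRing k σ →+* _) = ξ := by
    apply ringHom_coordRing_ext
    · intro c
      simp only [RingHom.comp_apply, coe_eval₂RingHom, RingHom.coe_coe, AlgHom.commutes,
        Polynomial.algebraMap_apply, eval₂_C]
    · intro m
      simp only [RingHom.comp_apply, coe_eval₂RingHom, RingHom.coe_coe, demazureCoaction_chi,
        eval₂_demazurePoly]
      rw [Finset.sum_range_succ']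
      have : chiOrZero k σ (m : Fin n → ℤ) = chi k m := chiOrZero_of_mem m.2
      simp [this]
  exact RingHom.congr_fun this r

/-- The addition axiom on `B`-valued points. On characters it is `sum_choose_add_pow`, since m + ie
pairs with `s` to ⟨s,m⟩ - i. -/
theorem eval₂_add_demazureCoaction {s e : Fin n → ℤ} (h : IsDemazureRoot σ s e) {B : Type*}
    [CommRing B] (ξ : coordRing k σ →+* B) (a b : B) (r : coordRing k σ) :
    (demazureCoaction k h r).eval₂ ξ (a + b) = (demazureCoaction k h r).eval₂
      ((eval₂RingHom ξ b).comp (demazureCoaction k h : coordRing k σ →+* _)) a := by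
  have : (eval₂RingHom ξ (a + b)).comp (demazureCoaction k h : coordRing k σ →+* _) =
      (eval₂RingHom ((eval₂RingHom ξ b).comp (demazureCoaction k h : coordRing k σ →+* _)) a).comp
        (demazureCoaction k h : coordRing k σ →+* _) := by
    apply ringHom_coordRing_ext
    · intro c
      simp only [RingHom.comp_apply, coe_eval₂RingHom, RingHom.coe_coe, AlgHom.commutes,
        Polynomial.algebraMap_apply, eval₂_C]
    · intro m
      simp only [RingHom.comp_apply, coe_eval₂RingHom, RingHom.coe_coe, demazureCoaction_chi,
        eval₂_demazurePoly]
      rw [sum_choose_add_pow (fun q => ξ (chiOrZero k σ (m + q • e)))]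
      refine Finset.sum_congr rfl fun i hi => ?_
      have hi' := Nat.lt_succ_iff.1 (Finset.mem_range.1 hi)
      rw [chiOrZero_of_mem (h.add_nsmul_mem m.2 hi'), demazureCoaction_chi, eval₂_demazurePoly]
      have hd : (s ⬝ᵥ ((m : Fin n → ℤ) + i • e)).toNat = (s ⬝ᵥ (m : Fin n → ℤ)).toNat - i := by
        rw [dotProduct_add, dotProduct_smul, h.eq_neg_one, nsmul_eq_mul]
        omega
      rw [hd]
      simp_rw [add_assoc, ← add_nsmul]
      ring
  exact RingHom.congr_fun this r

/-- Conjugation by t scales the term χ^{m+ie} aⁱ by χ^{m+ie}(t) χ^m(t)⁻¹ = χ^e(t)ⁱ, just as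
replacing a by χ^e(t) a does. -/
theorem demazureCoaction_homogeneous {s e : Fin n → ℤ} (h : IsDemazureRoot σ s e) {B : Type*}
    [CommRing B] (ξ : coordRing k σ →+* B) (a : B) (t : Fin n → kˣ) (r : coordRing k σ) :
    (demazureCoaction k h (torusOnFunctions σ t⁻¹ r)).eval₂
        (ξ.comp (torusOnFunctions σ t : coordRing k σ →+* _)) a =
      (demazureCoaction k h r).eval₂ ξ (ξ (algebraMap k _ (character e t : k)) * a) := by
  have : ((eval₂RingHom (ξ.comp (torusOnFunctions σ t : coordRing k σ →+* _)) a).comp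
      (demazureCoaction k h : coordRing k σ →+* _)).comp
        (torusOnFunctions σ t⁻¹ : coordRing k σ →+* _) =
      (eval₂RingHom ξ (ξ (algebraMap k _ (character e t : k)) * a)).comp
        (demazureCoaction k h : coordRing k σ →+* _) := by
    apply ringHom_coordRing_ext
    · intro c
      simp only [RingHom.comp_apply, coe_eval₂RingHom, RingHom.coe_coe, AlgHom.commutes,
        Polynomial.algebraMap_apply, eval₂_C]
    · intro m
      simp only [RingHom.comp_apply, coe_eval₂RingHom, RingHom.coe_coe, torusOnFunctions_chi_mul,
        map_mul, Polynomial.algebraMap_apply, demazureCoaction_chi, eval₂_demazurePoly,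
        eval₂_C, AlgHom.commutes]
      rw [Finset.mul_sum]
      refine Finset.sum_congr rfl fun i hi => ?_
      have hi' := Nat.lt_succ_iff.1 (Finset.mem_range.1 hi)
      rw [chiOrZero_of_mem (h.add_nsmul_mem m.2 hi')]
      simp only [torusOnFunctions_chi_mul, map_mul, character_add, character_nsmul, character_inv,
        Units.val_mul, Units.val_pow_eq_pow_val, map_pow, mul_pow]
      have hinv : ξ (algebraMap k _ (((character (m : Fin n → ℤ) t)⁻¹ : kˣ) : k)) *
          ξ (algebraMap k _ ((character (m : Fin n → ℤ) t : kˣ) : k)) = 1 := by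
        rw [← map_mul, ← map_mul, Units.inv_mul, map_one, map_one]
      linear_combination (((s ⬝ᵥ (m : Fin n → ℤ)).toNat.choose i : B) *
        ξ (algebraMap k _ (character e t : k)) ^ i *
        ξ (chi k ⟨_, h.add_nsmul_mem m.2 hi'⟩) * a ^ i) * hinv
  exact RingHom.congr_fun this r

/-- The linear coefficient at χ^m is ⟨s,m⟩ χ^{m+e}, nonzero in characteristic zero. -/
theorem demazureCoaction_ne [CharZero k] {s e : Fin n → ℤ} (h : IsDemazureRoot σ s e)
    (hm : ∃ m ∈ dualMonoid σ, 0 < s ⬝ᵥ m) :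
    ∃ r : coordRing k σ, demazureCoaction k h r ≠ C r := by
  obtain ⟨m, hm, hpos⟩ := hm
  refine ⟨chi k ⟨m, hm⟩, fun heq => ?_⟩
  have h1 := congrArg (fun p => coeff p 1) heq
  simp only [demazureCoaction_chi, demazurePoly, finsetSum_coeff, coeff_C_mul_X_pow] at h1
  rw [Finset.sum_eq_single_of_mem 1 (Finset.mem_range.2 (by omega)) (by
    intro j _ hj; rw [if_neg (Ne.symm hj)]), if_pos rfl,
    chiOrZero_of_mem (h.add_nsmul_mem hm (i := 1) (by omega)), coeff_C_of_ne_zero one_ne_zero,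
    Nat.choose_one_right] at h1
  rcases mul_eq_zero.1 h1 with h2 | h2
  · rw [Nat.cast_eq_zero] at h2
    omega
  · exact chi_ne_zero _ h2

end DemazureCoaction

/-! ### Points with values in a scheme, and functions on 𝔸¹_X -/

section Points

open Polynomial

variable {R : Type u} [CommRing R] {S S' X : Scheme.{u}}

/-- The ring homomorphism `R → Γ(S, 𝒪_S)` of a morphism `S ⟶ Spec R`. -/
def sectionsHom (y : S ⟶ Spec (CommRingCat.of R)) : R →+* Γ(S, ⊤) :=
  ((Scheme.ΓSpecIso (CommRingCat.of R)).inv ≫ y.appTop).hom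

theorem sectionsHom_comp (f : S' ⟶ S) (y : S ⟶ Spec (CommRingCat.of R)) (r : R) :
    sectionsHom (f ≫ y) r = f.appTop (sectionsHom y r) := by
  simp only [sectionsHom, Scheme.Hom.comp_appTop, CommRingCat.hom_comp, RingHom.comp_apply]

theorem sectionsHom_comp' (f : S' ⟶ S) (y : S ⟶ Spec (CommRingCat.of R)) :
    sectionsHom (f ≫ y) = f.appTop.hom.comp (sectionsHom y) :=
  RingHom.ext (sectionsHom_comp f y)

theorem sectionsHom_comp_SpecMap {R' : Type u} [CommRing R'] (y : S ⟶ Spec (CommRingCat.of R))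
    (φ : R' →+* R) :
    sectionsHom (y ≫ Spec.map (CommRingCat.ofHom φ)) = (sectionsHom y).comp φ := by
  have := Scheme.ΓSpecIso_inv_naturality (CommRingCat.ofHom φ)
  unfold sectionsHom
  rw [Scheme.Hom.comp_appTop, ← Category.assoc, ← this, Category.assoc, CommRingCat.hom_comp]
  rfl

/-- The morphism `S ⟶ Spec R` of a ring homomorphism `R → Γ(S, 𝒪_S)`. -/
def homOfSections (f : R →+* Γ(S, ⊤)) : S ⟶ Spec (CommRingCat.of R) :=
  S.toSpecΓ ≫ Spec.map (CommRingCat.ofHom f)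

theorem sectionsHom_homOfSections (f : R →+* Γ(S, ⊤)) : sectionsHom (homOfSections f) = f := by
  unfold homOfSections
  rw [sectionsHom_comp_SpecMap]
  have : sectionsHom S.toSpecΓ = RingHom.id _ := by
    unfold sectionsHom
    rw [Scheme.toSpecΓ_appTop]
    exact congrArg CommRingCat.Hom.hom (Iso.inv_hom_id _)
  exact (congrArg (fun g => RingHom.comp g f) this)

theorem homOfSections_sectionsHom (y : S ⟶ Spec (CommRingCat.of R)) :
    homOfSections (sectionsHom y) = y := by
  unfold homOfSections sectionsHom
  rw [CommRingCat.ofHom_hom, Spec.map_comp, ← Category.assoc, ← Scheme.toSpecΓ_naturality,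
    Category.assoc]
  simp

theorem sectionsHom_injective :
    Function.Injective (sectionsHom : (S ⟶ Spec (CommRingCat.of R)) → _) :=
  Function.LeftInverse.injective homOfSections_sectionsHom

theorem mem_basicOpen_sectionsHom (y : S ⟶ Spec (CommRingCat.of R)) (r : R) (p : S) :
    p ∈ S.basicOpen (sectionsHom y r) ↔ r ∉ (y p).asIdeal := by
  have h : y ⁻¹ᵁ ((Spec (CommRingCat.of R)).basicOpen
      ((Scheme.ΓSpecIso (CommRingCat.of R)).inv r)) = S.basicOpen (sectionsHom y r) :=
    Scheme.preimage_basicOpen_top _ _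
  rw [← h, basicOpen_eq_of_affine]
  rfl

/-- The homomorphism `R[t] → Γ(𝔸¹_X, 𝒪)` defined by `j : X ⟶ Spec R` and the coordinate. -/
def polynomialToSections (j : X ⟶ Spec (CommRingCat.of R)) :
    R[X] →+* Γ(𝔸(PUnit.{u + 1}; X), ⊤) :=
  eval₂RingHom (sectionsHom ((𝔸(PUnit.{u + 1}; X) ↘ X) ≫ j)) (AffineSpace.coord X PUnit.unit)

/-- Flat base change: 𝔸¹_X is the pullback of the flat 𝔸¹_R → Spec R along `j`, and X is
quasi-compact and quasi-separated. So an isomorphism R ≅ Γ(X) induces R[t] ≅ Γ(𝔸¹_X), even if X is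
not affine. -/
theorem bijective_polynomialToSections (j : X ⟶ Spec (CommRingCat.of R)) [CompactSpace X]
    [QuasiSeparatedSpace X] [IsIso j.appTop] :
    Function.Bijective (polynomialToSections j) := by
  have hflat : Flat (𝔸(PUnit.{u + 1}; Spec (CommRingCat.of R)) ↘ Spec (CommRingCat.of R)) := by
    have hC : Flat (Spec.map (CommRingCat.ofHom
        (MvPolynomial.C : R →+* MvPolynomial PUnit.{u + 1} R))) :=
      Flat.SpecMap_iff.2
        (RingHom.flat_algebraMap_iff.2 (inferInstanceAs (Module.Flat R (MvPolynomial PUnit R))))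
    have := AffineSpace.SpecIso_inv_over (n := PUnit.{u + 1}) (CommRingCat.of R)
    rw [Iso.inv_comp_eq] at this
    rw [this]
    infer_instance
  have H := AffineSpace.isPullback_map (n := PUnit.{u + 1}) j
  have h1 := isIso_pushoutSection_of_isQuasiSeparated_of_flat_left H (US := ⊤) (UX := ⊤) (UT := ⊤)
    (UY := ⊤) (by simp) (by simp) (by simp) (isAffineOpen_top _) (isAffineOpen_top _)
    isCompact_univ isQuasiSeparated_univ
  have h2 := (isIso_pushoutSection_iff H _ _ _).1 h1
  have h3 : IsIso (AffineSpace.map PUnit.{u + 1} j).appTop := by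
    have e1 : j.appLE ⊤ ⊤ le_top = j.appTop := (Scheme.Hom.app_eq_appLE j (U := ⊤)).symm
    have h4 : IsIso (j.appLE ⊤ ⊤ le_top) := by
      rw [e1]; assumption
    have e2 : (AffineSpace.map PUnit.{u + 1} j).appTop =
      (AffineSpace.map PUnit.{u + 1} j).appLE ⊤ ⊤ le_top := Scheme.Hom.app_eq_appLE _ (U := ⊤)
    rw [e2]
    exact h2.isIso_inl_of_isIso h4
  let g := AffineSpace.SpecIso PUnit.{u + 1} (CommRingCat.of R)
  let h : MvPolynomial PUnit.{u + 1} R →+* Γ(𝔸(PUnit.{u + 1}; X), ⊤) :=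
    sectionsHom (AffineSpace.map PUnit.{u + 1} j ≫ g.hom)
  have hh : Function.Bijective h := by
    have : IsIso ((Scheme.ΓSpecIso _).inv ≫
        (AffineSpace.map PUnit.{u + 1} j ≫ g.hom).appTop) := by
      have h4 : IsIso g.hom.appTop := inferInstanceAs (IsIso (g.hom.app ⊤))
      have h5 : IsIso (g.hom.appTop ≫ (AffineSpace.map PUnit.{u + 1} j).appTop) :=
        IsIso.comp_isIso' h4 h3
      rw [Scheme.Hom.comp_appTop]
      exact IsIso.comp_isIso' inferInstance h5
    exact ConcreteCategory.bijective_of_isIso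
      ((Scheme.ΓSpecIso _).inv ≫ (AffineSpace.map PUnit.{u + 1} j ≫ g.hom).appTop)
  let e := (MvPolynomial.uniqueAlgEquiv R PUnit.{u + 1}).symm
  have heq : polynomialToSections j = h.comp (e : R[X] →+* MvPolynomial PUnit.{u + 1} R) := by
    apply Polynomial.ringHom_ext
    · intro r
      have h6 : g.hom ≫ Spec.map (CommRingCat.ofHom MvPolynomial.C) =
          𝔸(PUnit.{u + 1}; Spec (CommRingCat.of R)) ↘ Spec (CommRingCat.of R) := by
        rw [← AffineSpace.SpecIso_inv_over, Iso.hom_inv_id_assoc]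
      have h7 : h.comp MvPolynomial.C = sectionsHom ((𝔸(PUnit.{u + 1}; X) ↘ X) ≫ j) := by
        rw [← sectionsHom_comp_SpecMap, Category.assoc, h6, AffineSpace.map_over]
      have h8 : e (C r) = MvPolynomial.C r := e.commutes r
      simp only [polynomialToSections, coe_eval₂RingHom, eval₂_C, RingHom.comp_apply,
        RingHom.coe_coe, h8, ← h7]
    · have h8 : e Polynomial.X = MvPolynomial.X PUnit.unit := by simp [e]
      have h9 : (AffineSpace.SpecIso PUnit.{u + 1} (CommRingCat.of R)).hom.appTop
          ((Scheme.ΓSpecIso _).inv (MvPolynomial.X PUnit.unit)) =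
          AffineSpace.coord (Spec (CommRingCat.of R)) PUnit.unit := by
        rw [AffineSpace.SpecIso_hom_appTop]
        simp
      simp only [polynomialToSections, coe_eval₂RingHom, eval₂_X, RingHom.comp_apply,
        RingHom.coe_coe, h, sectionsHom_comp]
      rw [h8, ← AffineSpace.map_appTop_coord j, ← h9]
      rfl
  rw [heq]
  exact hh.comp e.bijective

/-- Pulling back along the point (x, a) of 𝔸¹_X is evaluation at a; this turns the axioms of an
action into polynomial identities. -/
theorem homOfVector_appTop_polynomialToSections (j : X ⟶ Spec (CommRingCat.of R)) (x : S ⟶ X)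
    (a : Γ(S, ⊤)) (p : R[X]) :
    (AffineSpace.homOfVector x fun _ : PUnit.{u + 1} => a).appTop (polynomialToSections j p) =
      p.eval₂ (sectionsHom (x ≫ j)) a := by
  have h1 : (AffineSpace.homOfVector x fun _ : PUnit.{u + 1} => a).appTop.hom.comp
      (sectionsHom ((𝔸(PUnit.{u + 1}; X) ↘ X) ≫ j)) = sectionsHom (x ≫ j) := by
    rw [← sectionsHom_comp', ← Category.assoc, AffineSpace.homOfVector_over]
  have h2 := hom_eval₂ p (sectionsHom ((𝔸(PUnit.{u + 1}; X) ↘ X) ≫ j))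
    (AffineSpace.homOfVector x fun _ : PUnit.{u + 1} => a).appTop.hom
    (AffineSpace.coord X PUnit.unit)
  rw [h1] at h2
  refine h2.trans ?_
  congr 1
  exact AffineSpace.homOfVector_appTop_coord _ _ _

/-- A morphism `𝔸¹_X ⟶ X` is given, on the level of functions, by a homomorphism `R → R[t]`, if
`R` is the ring of global functions of `X`. -/
theorem exists_coaction (j : X ⟶ Spec (CommRingCat.of R)) [CompactSpace X]
    [QuasiSeparatedSpace X] [IsIso j.appTop] (act : 𝔸(PUnit.{u + 1}; X) ⟶ X) :
    ∃ E : R →+* R[X], ∀ {S : Scheme.{u}} (x : S ⟶ X) (a : Γ(S, ⊤)),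
      sectionsHom ((AffineSpace.homOfVector x (fun _ => a) ≫ act) ≫ j) =
        (eval₂RingHom (sectionsHom (x ≫ j)) a).comp E := by
  let e := RingEquiv.ofBijective (polynomialToSections j) (bijective_polynomialToSections j)
  refine ⟨(e.symm : _ →+* R[X]).comp (sectionsHom (act ≫ j)), fun x a => RingHom.ext fun r => ?_⟩
  rw [Category.assoc, sectionsHom_comp]
  simp only [RingHom.comp_apply, coe_eval₂RingHom, RingHom.coe_coe]
  rw [← homOfVector_appTop_polynomialToSections]
  exact congrArg _ (e.apply_symm_apply _).symm

end Points

/-! ### The open immersion into X_σ, and derivations from actions -/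

section AffineModel

open Polynomial

variable {k : Type u} [Field k] {n : ℕ}

/-- A torus-equivariant open immersion over `k` of the toric variety `X_Σ` into `X_σ` which is an
isomorphism on global functions. -/
structure IsAffineModel (Δ : ConeFan n) (σ : PointedCone ℝ (Fin n → ℝ))
    (j : toricVariety k Δ ⟶ Spec (CommRingCat.of (coordRing k σ))) : Prop where
  compactSpace : CompactSpace (toricVariety k Δ)
  quasiSeparatedSpace : QuasiSeparatedSpace (toricVariety k Δ)
  isOpenImmersion : IsOpenImmersion j
  isIso_appTop : IsIso j.appTop
  comp_str : j ≫ affineToricStr k σ = toricStr k Δ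
  torusAct_comp : ∀ t : Fin n → kˣ, torusAct Δ t ≫ j = j ≫ affineTorusAct σ t

/-- Quasi-affineness says that X → Spec Γ(X) is an open immersion; it is natural, hence equivariant,
and is composed with the given isomorphism to X_σ. -/
theorem exists_isAffineModel {Δ : ConeFan n} (hX : (toricVariety k Δ).IsQuasiAffine)
    {σ : PointedCone ℝ (Fin n → ℝ)} (hXσ : AffinizationIs k Δ σ) :
    ∃ j : toricVariety k Δ ⟶ Spec (CommRingCat.of (coordRing k σ)), IsAffineModel Δ σ j := by
  obtain ⟨φ, hstr, hact⟩ := hXσ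
  refine ⟨(toricVariety k Δ).toSpecΓ ≫ φ.hom, ⟨inferInstance, inferInstance, inferInstance, ?_,
    ?_, fun t => ?_⟩⟩
  · rw [Scheme.Hom.comp_appTop, Scheme.toSpecΓ_appTop]
    have : IsIso φ.hom.appTop := inferInstanceAs (IsIso (φ.hom.app ⊤))
    infer_instance
  · rw [Category.assoc, hstr, Spec.map_comp, ← Category.assoc, ← Scheme.toSpecΓ_naturality,
      Category.assoc]
    simp
  · rw [← Category.assoc, Scheme.toSpecΓ_naturality, Category.assoc, Category.assoc, hact t]

variable {Δ : ConeFan n} {σ : PointedCone ℝ (Fin n → ℝ)}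
  {j : toricVariety k Δ ⟶ Spec (CommRingCat.of (coordRing k σ))}

theorem IsAffineModel.bijective_polynomialToSections (hj : IsAffineModel Δ σ j) :
    Function.Bijective (polynomialToSections j) := by
  have := hj.compactSpace
  have := hj.quasiSeparatedSpace
  have := hj.isIso_appTop
  exact Toric.bijective_polynomialToSections j

theorem IsAffineModel.bijective_sectionsHom (hj : IsAffineModel Δ σ j) :
    Function.Bijective (sectionsHom j) := by
  have := hj.isIso_appTop
  exact ConcreteCategory.bijective_of_isIso ((Scheme.ΓSpecIso _).inv ≫ j.appTop)

theorem IsAffineModel.constant_eq (hj : IsAffineModel Δ σ j) {S : Scheme.{u}}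
    (x : S ⟶ toricVariety k Δ) (c : k) :
    constant (x ≫ toricStr k Δ) c = sectionsHom (x ≫ j) (algebraMap k (coordRing k σ) c) := by
  have h : sectionsHom (x ≫ toricStr k Δ) =
      (sectionsHom (x ≫ j)).comp (algebraMap k (coordRing k σ)) := by
    rw [← hj.comp_str, ← sectionsHom_comp_SpecMap, Category.assoc]
    rfl
  exact RingHom.congr_fun h c

theorem IsAffineModel.sectionsHom_torusAct (hj : IsAffineModel Δ σ j) {S : Scheme.{u}}
    (x : S ⟶ toricVariety k Δ)
    (t : Fin n → kˣ) : sectionsHom ((x ≫ torusAct Δ t) ≫ j) =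
      (sectionsHom (x ≫ j)).comp (torusOnFunctions σ t⁻¹ : coordRing k σ →+* _) := by
  rw [← sectionsHom_comp_SpecMap, Category.assoc, hj.torusAct_comp, Category.assoc]
  rfl

theorem eval₂_polynomialToSections {R : Type u} [CommRing R] {X : Scheme.{u}}
    (j : X ⟶ Spec (CommRingCat.of R)) (p q : R[X]) :
    p.eval₂ (sectionsHom ((𝔸(PUnit.{u + 1}; X) ↘ X) ≫ j)) (polynomialToSections j q) =
      polynomialToSections j (p.eval₂ C q) := by
  rw [hom_eval₂]
  congr 1
  refine RingHom.ext fun r => ?_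
  simp [polynomialToSections]

/-- The weight of a nontrivial homogeneous `𝔾ₐ`-action on `X_Σ` is the degree of a nonzero
homogeneous locally nilpotent derivation of `k[σ^∨_M]`. -/
theorem IsAffineModel.exists_derivation [CharZero k] (hj : IsAffineModel Δ σ j)
    {e : Fin n → ℤ} (he : e ∈ weights k Δ) :
    ∃ D : Derivation k (coordRing k σ) (coordRing k σ),
      IsHomogeneousDerivation D e ∧ D ≠ 0 ∧ ∀ f, ∃ N : ℕ, D^[N] f = 0 := by
  obtain ⟨ε, hε, hhom⟩ := he
  have := hj.compactSpace
  have := hj.quasiSeparatedSpace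
  have := hj.isIso_appTop
  have := hj.isOpenImmersion
  obtain ⟨E, hE⟩ := exists_coaction j ε.act
  let Φ := polynomialToSections j
  have hΦ : Function.Injective Φ := hj.bijective_polynomialToSections.1
  let π := 𝔸(PUnit.{u + 1}; toricVariety k Δ) ↘ toricVariety k Δ
  have hπ : sectionsHom (π ≫ j) = Φ.comp C := by
    refine RingHom.ext fun r => ?_
    simp [Φ, polynomialToSections, π]
  have hmove : ∀ {S : Scheme.{u}} (x : S ⟶ toricVariety k Δ) (a : Γ(S, ⊤)),
      sectionsHom (ε.move a x ≫ j) = (eval₂RingHom (sectionsHom (x ≫ j)) a).comp E := hE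
  have hmove' : ∀ (q : (coordRing k σ)[X]) (r : coordRing k σ),
      sectionsHom (ε.move (Φ q) π ≫ j) r = Φ ((E r).eval₂ C q) := by
    intro q r
    rw [hmove, ← eval₂_polynomialToSections]
    rfl
  have hΦX : Φ X = AffineSpace.coord _ PUnit.unit := by simp [Φ, polynomialToSections]
  -- The universal point of 𝔸¹_X, with the coordinate as group element; the axioms are read off at
  -- this point and its variants.
  have hact : ε.move (Φ X) π = ε.act := by
    have h1 : AffineSpace.homOfVector π (fun _ : PUnit.{u + 1} => Φ X) = 𝟙 _ := by
      apply AffineSpace.hom_ext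
      · rw [AffineSpace.homOfVector_over, Category.id_comp]
      · intro i
        rw [AffineSpace.homOfVector_appTop_coord, hΦX]
        simp
    rw [GaAction.move, h1, Category.id_comp]
  have hEX : ∀ r, sectionsHom (ε.act ≫ j) r = Φ (E r) := by
    intro r
    rw [← hact, hmove', eval₂_C_X]
  have hEc : ∀ c : k, E (algebraMap k _ c) = C (algebraMap k _ c) := by
    intro c
    apply hΦ
    rw [← hEX, ← hj.constant_eq, ε.act_over]
    change constant (π ≫ toricStr k Δ) c = (Φ.comp C) _
    rw [hj.constant_eq, hπ]
  let F : coordRing k σ →ₐ[k] (coordRing k σ)[X] := { E with commutes' := hEc }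
  have hF : (F : coordRing k σ →+* (coordRing k σ)[X]) = E := rfl
  have hF' : ∀ r, F r = E r := fun _ => rfl
  have h0 : ∀ r, (F r).coeff 0 = r := by
    intro r
    have h1 := hmove' 0 r
    rw [map_zero, GaAction.move, ε.zero_act π, hπ] at h1
    have h2 := congrArg (fun p => coeff p 0) (hΦ h1)
    simp only [coeff_C_zero] at h2
    rw [eval₂_at_zero, coeff_C_zero] at h2
    exact h2.symm
  have hadd : IsAdditiveCoaction F := by
    intro c r
    rw [hF, hF']
    apply hΦ
    rw [← hmove', map_add]
    have h1 : ε.move (Φ X + Φ (C (algebraMap k _ c))) π =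
      ε.move (Φ X) (ε.move (Φ (C (algebraMap k _ c))) π) := ε.add_act π _ _
    rw [h1, hmove]
    have h2 : sectionsHom (ε.move (Φ (C (algebraMap k _ c))) π ≫ j) =
        Φ.comp ((eval₂RingHom C (C (algebraMap k _ c))).comp E) := by
      refine RingHom.ext fun r => ?_
      rw [hmove']
      rfl
    rw [h2]
    exact (hom_eval₂ _ _ _ _).symm
  refine ⟨coactionDerivation F h0, ?_, coactionDerivation_ne_zero F h0 hadd ?_,
    iterate_coactionDerivation_eq_zero F h0 hadd⟩
  · have hw : ∀ (t : Fin n → kˣ) (r : coordRing k σ),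
        torusOnFunctions σ t (coactionDerivation F h0 (torusOnFunctions σ t⁻¹ r)) =
          (character e t : k) • coactionDerivation F h0 r := by
      intro t r
      have h1 := congrArg (fun x => sectionsHom (x ≫ j) r) (hhom t (Φ X) π)
      have h2 : sectionsHom ((π ≫ torusAct Δ t⁻¹) ≫ j) =
          Φ.comp (C.comp (torusOnFunctions σ t : coordRing k σ →+* _)) := by
        rw [hj.sectionsHom_torusAct, inv_inv, hπ, RingHom.comp_assoc]
      have h3 : constant (π ≫ toricStr k Δ) (character e t : k) * Φ X =
          Φ (C (algebraMap k _ (character e t : k)) * X) := by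
        rw [hj.constant_eq, hπ, map_mul]
        rfl
      simp only [h3, hmove'] at h1
      rw [hj.sectionsHom_torusAct, hmove, h2, RingHom.comp_apply, RingHom.comp_apply,
        RingHom.coe_coe, coe_eval₂RingHom] at h1
      have h4 := (hom_eval₂ (E (torusOnFunctions σ t⁻¹ r))
        (C.comp (torusOnFunctions σ t : coordRing k σ →+* _)) Φ X).trans h1
      have h5 := congrArg (fun p => coeff p 1) (hΦ h4)
      change coeff (Polynomial.map (torusOnFunctions σ t : coordRing k σ →+* _) _) 1 =
        coeff ((E r).comp _) 1 at h5
      rw [coeff_map, comp_C_mul_X_coeff, pow_one] at h5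
      rw [Algebra.smul_def, mul_comm]
      exact h5
    intro m q hq
    by_contra hne
    -- Only the exponent m + e has the required weight for all t, so any other exponent q is
    -- excluded by a t that separates the two characters.
    obtain ⟨t, ht⟩ := exists_character_ne (k := k) hne
    have h1 := congrArg (fun f => f.coeff q) (hw t (chi k m))
    simp only [torusOnFunctions_chi, Derivation.map_smul, map_smul, AddMonoidAlgebra.coeff_smul,
      Finsupp.smul_apply, coeff_torusOnFunctions, smul_eq_mul, character_inv] at h1
    rw [mul_left_comm, mul_comm (character e t : k)] at h1
    have h2 := mul_left_cancel₀ hq h1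
    apply ht
    rw [character_add]
    ext
    rw [Units.val_mul, ← h2, ← mul_assoc, ← Units.val_mul, mul_inv_cancel, Units.val_one, one_mul]
  · by_contra! h
    apply hε
    have h1 : ε.act ≫ j = π ≫ j := by
      apply sectionsHom_injective
      refine RingHom.ext fun r => ?_
      rw [hEX, hπ, ← hF', h]
      rfl
    exact (cancel_mono j).1 h1

end AffineModel

/-! ### Gluing compatible fractions -/

section Gluing

/-- Fractions `b i / a i` which agree with each other and whose denominators do not vanish
simultaneously glue to a global function. -/
theorem exists_section_mul_eq {X : Scheme.{u}} {ι : Type u} (a b : ι → Γ(X, ⊤))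
    (hcover : ∀ x : X, ∃ i, x ∈ X.basicOpen (a i)) (hab : ∀ i j, b i * a j = b j * a i) :
    ∃ f : Γ(X, ⊤), ∀ i, f * a i = b i := by
  let U : ι → X.Opens := fun i => X.basicOpen (a i)
  let ρ : ∀ {V W : X.Opens}, (V ⟶ W) → (Γ(X, W) →+* Γ(X, V)) := fun g => (X.presheaf.map g.op).hom
  have hρ : ∀ {V W Z : X.Opens} (g : V ⟶ W) (h : W ⟶ Z) (f : Γ(X, Z)),
      ρ g (ρ h f) = ρ (g ≫ h) f := by
    intro V W Z g h f
    simp only [ρ, op_comp, Functor.map_comp, CommRingCat.hom_comp, RingHom.comp_apply]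
  have hunit : ∀ i, IsUnit (ρ (homOfLE (le_top : U i ≤ ⊤)) (a i)) := fun i =>
    X.toRingedSpace.isUnit_res_basicOpen (a i)
  choose c hc using fun i => (hunit i).exists_right_inv
  have hcov : (⊤ : X.Opens) ≤ iSup U := fun x _ =>
    TopologicalSpace.Opens.mem_iSup.2 (hcover x)
  have hcompat : TopCat.Presheaf.IsCompatible X.sheaf.1 U
      (fun i => ρ (homOfLE (le_top : U i ≤ ⊤)) (b i) * c i) := by
    intro i j
    change ρ (TopologicalSpace.Opens.infLELeft (U i) (U j)) _ =
      ρ (TopologicalSpace.Opens.infLERight (U i) (U j)) _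
    have h1 := congrArg (ρ (TopologicalSpace.Opens.infLELeft (U i) (U j))) (hc i)
    have h2 := congrArg (ρ (TopologicalSpace.Opens.infLERight (U i) (U j))) (hc j)
    have h3 := congrArg (ρ (homOfLE (le_top : U i ⊓ U j ≤ ⊤))) (hab i j)
    rw [map_mul, hρ, map_one] at h1 h2
    rw [map_mul, map_mul] at h3
    rw [map_mul, map_mul, hρ, hρ]
    change ρ (homOfLE le_top) _ * _ = 1 at h1 h2
    change ρ (homOfLE le_top) _ * _ = ρ (homOfLE le_top) _ * _
    generalize ρ (TopologicalSpace.Opens.infLELeft (U i) (U j)) (c i) = ci at *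
    generalize ρ (TopologicalSpace.Opens.infLERight (U i) (U j)) (c j) = cj at *
    generalize ρ (homOfLE (le_top : U i ⊓ U j ≤ ⊤)) (a i) = ai at *
    generalize ρ (homOfLE (le_top : U i ⊓ U j ≤ ⊤)) (a j) = aj at *
    linear_combination ci * cj * h3 + ρ (homOfLE le_top) (b j) * cj * h1 -
      ρ (homOfLE le_top) (b i) * ci * h2
  obtain ⟨f, hf, -⟩ := X.sheaf.existsUnique_gluing' U ⊤ (fun i => homOfLE le_top) hcov _ hcompat
  change Γ(X, ⊤) at f
  refine ⟨f, fun i => ?_⟩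
  refine X.sheaf.eq_of_locally_eq' U ⊤ (fun i => homOfLE le_top) hcov _ _ fun l => ?_
  change ρ (homOfLE (le_top : U l ≤ ⊤)) (f * a i) = ρ (homOfLE (le_top : U l ≤ ⊤)) (b i)
  have h1 : ρ (homOfLE (le_top : U l ≤ ⊤)) f = ρ (homOfLE (le_top : U l ≤ ⊤)) (b l) * c l := hf l
  have h3 := congrArg (ρ (homOfLE (le_top : U l ≤ ⊤))) (hab i l)
  rw [map_mul, map_mul] at h3
  rw [map_mul, h1]
  linear_combination (-c l) * h3 + ρ (homOfLE (le_top : U l ≤ ⊤)) (b i) * hc l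

end Gluing

/-! ### Torus-stable ideals are spanned by characters -/

section TorusStable

variable {k : Type u} [Field k] {n : ℕ} {σ : PointedCone ℝ (Fin n → ℝ)}

/-- A torus-stable ideal of `k[σ^∨_M]` contains the characters which occur in its elements. -/
theorem chi_mem_of_torus_stable [CharZero k] (I : Ideal (coordRing k σ))
    (hI : ∀ (t : Fin n → kˣ), ∀ f ∈ I, torusOnFunctions σ t f ∈ I) {f : coordRing k σ} (hf : f ∈ I)
    {m : dualMonoid σ} (hm : f.coeff m ≠ 0) : chi k m ∈ I := by
  classical
  induction hN : f.coeff.support.card using Nat.strong_induction_on generalizing f with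
  | _ N ih =>
    by_cases h : ∃ q, q ≠ m ∧ f.coeff q ≠ 0
    · obtain ⟨q, hqm, hq⟩ := h
      obtain ⟨t, ht⟩ := exists_character_ne (k := k)
        (show (m : Fin n → ℤ) ≠ q from fun h => hqm (Subtype.ext h.symm))
      -- Removes the exponent `q` from the support and keeps `m`, whose coefficient is scaled by
      -- χ^m(t) - χ^q(t) ≠ 0; then induct on the size of the support.
      let g := torusOnFunctions σ t f - (character (q : Fin n → ℤ) t : k) • f
      have hg : ∀ l : dualMonoid σ, g.coeff l =
          f.coeff l * ((character (l : Fin n → ℤ) t : k) - (character (q : Fin n → ℤ) t : k)) := by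
        intro l
        simp only [g, AddMonoidAlgebra.coeff_sub, Finsupp.sub_apply, coeff_torusOnFunctions,
          AddMonoidAlgebra.coeff_smul, Finsupp.smul_apply, smul_eq_mul]
        ring
      have hgI : g ∈ I := I.sub_mem (hI t f hf) (Submodule.smul_of_tower_mem I _ hf)
      have hgm : g.coeff m ≠ 0 := by
        rw [hg]
        exact mul_ne_zero hm (sub_ne_zero.2 fun h => ht (Units.ext h))
      refine ih _ ?_ hgI hgm rfl
      rw [← hN]
      refine Finset.card_lt_card (Finset.ssubset_iff_of_subset (fun l hl => ?_) |>.2 ⟨q, ?_, ?_⟩)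
      · rw [Finsupp.mem_support_iff, hg] at hl
        exact Finsupp.mem_support_iff.2 (left_ne_zero_of_mul hl)
      · exact Finsupp.mem_support_iff.2 hq
      · rw [Finsupp.notMem_support_iff, hg, sub_self, mul_zero]
    · push Not at h
      have h1 : f = (f.coeff m) • chi k m := by
        rw [smul_chi]
        ext l
        rw [AddMonoidAlgebra.coeff_single, Finsupp.single_apply]
        split_ifs with hl
        · rw [hl]
        · exact h l (Ne.symm hl)
      have h2 : chi k m = (f.coeff m)⁻¹ • f := by
        generalize f.coeff m = c at h1 hm
        rw [h1, smul_smul, inv_mul_cancel₀ hm, one_smul]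
      rw [h2]
      exact Submodule.smul_of_tower_mem I _ hf

theorem notMem_ideal_of_chi_mem {J : Ideal (coordRing k σ)} {f : coordRing k σ} (hf : f ∉ J) :
    ∃ m, f.coeff m ≠ 0 ∧ chi k m ∉ J := by
  by_contra! h
  apply hf
  rw [← AddMonoidAlgebra.sum_coeff_single f]
  refine Submodule.sum_mem _ fun m hm => ?_
  rw [← smul_chi]
  exact Submodule.smul_of_tower_mem J _ (h m (Finsupp.mem_support_iff.1 hm))

theorem affineTorusAct_inv_comp (t : Fin n → kˣ) :
    affineTorusAct σ t⁻¹ ≫ affineTorusAct σ t = 𝟙 (affineToric k σ) := by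
  have h : ((torusOnFunctions σ t⁻¹⁻¹).toRingHom.comp (torusOnFunctions σ t⁻¹).toRingHom) =
      RingHom.id (coordRing k σ) := by
    refine ringHom_coordRing_ext (fun c => ?_) fun m => ?_
    · exact ((torusOnFunctions σ t⁻¹⁻¹).comp (torusOnFunctions σ t⁻¹)).commutes c
    · simp only [AlgHom.toRingHom_eq_coe, RingHom.comp_apply, RingHom.coe_coe, torusOnFunctions_chi,
        map_smul, smul_smul, character_inv, inv_inv, RingHom.id_apply]
      rw [← Units.val_mul, inv_mul_cancel, Units.val_one, one_smul]
  unfold affineTorusAct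
  rw [← Spec.map_comp, ← CommRingCat.ofHom_comp, h]
  exact Spec.map_id _

end TorusStable

/-! ### The ideal of the complement of X in X_σ -/

section BoundaryIdeal

variable {R : Type u} [CommRing R] {X : Scheme.{u}} (j : X ⟶ Spec (CommRingCat.of R))

/-- The ideal of functions vanishing outside of the image of `j`. -/
def boundaryIdeal : Ideal R := PrimeSpectrum.vanishingIdeal (R := R) (Set.range j)ᶜ

theorem mem_boundaryIdeal {r : R} :
    r ∈ boundaryIdeal j ↔ ∀ p : Spec (CommRingCat.of R), p ∉ Set.range j → r ∈ p.asIdeal :=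
  PrimeSpectrum.mem_vanishingIdeal _ _

theorem boundaryIdeal_isRadical : (boundaryIdeal j).IsRadical :=
  PrimeSpectrum.isRadical_vanishingIdeal _

theorem mem_range_iff_exists_boundaryIdeal [IsOpenImmersion j] (p : Spec (CommRingCat.of R)) :
    p ∈ Set.range j ↔ ∃ r ∈ boundaryIdeal j, r ∉ p.asIdeal := by
  constructor
  · intro hp
    have h1 : IsClosed (X := PrimeSpectrum R) (Set.range j)ᶜ :=
      j.isOpenEmbedding.isOpen_range.isClosed_compl
    have h2 := PrimeSpectrum.zeroLocus_vanishingIdeal_eq_closure (R := R) (Set.range j)ᶜ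
    rw [h1.closure_eq] at h2
    have h3 : p ∉ PrimeSpectrum.zeroLocus (R := R) (boundaryIdeal j : Set R) := fun h =>
      (h2.subset h) hp
    exact Set.not_subset.1 h3
  · rintro ⟨r, hr, hrp⟩
    by_contra h
    exact hrp ((mem_boundaryIdeal j).1 hr p h)

end BoundaryIdeal

section AffineModelBoundary

variable {k : Type u} [Field k] {n : ℕ} {Δ : ConeFan n} {σ : PointedCone ℝ (Fin n → ℝ)}
  {j : toricVariety k Δ ⟶ Spec (CommRingCat.of (coordRing k σ))}

theorem IsAffineModel.torusOnFunctions_mem_boundaryIdeal (hj : IsAffineModel Δ σ j)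
    (t : Fin n → kˣ) {f : coordRing k σ} (hf : f ∈ boundaryIdeal j) :
    torusOnFunctions σ t f ∈ boundaryIdeal j := by
  rw [mem_boundaryIdeal] at hf ⊢
  intro p hp
  have h1 := hf (affineTorusAct σ t⁻¹ p) ?_
  · have h2 : torusOnFunctions σ t⁻¹⁻¹ f ∈ p.asIdeal := h1
    rwa [inv_inv] at h2
  · rintro ⟨x, hx⟩
    apply hp
    refine ⟨torusAct Δ t x, ?_⟩
    rw [← Scheme.Hom.comp_apply, hj.torusAct_comp, Scheme.Hom.comp_apply, hx,
      ← Scheme.Hom.comp_apply, affineTorusAct_inv_comp]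
    rfl

/-- The complement of X is torus-stable, so its ideal contains the characters occurring in its
elements; thus X is the union of the D(χ^m) with χ^m in that ideal. -/
theorem IsAffineModel.mem_range_iff [CharZero k] (hj : IsAffineModel Δ σ j)
    (p : Spec (CommRingCat.of (coordRing k σ))) :
    p ∈ Set.range j ↔ ∃ m, chi k m ∈ boundaryIdeal j ∧ chi k m ∉ p.asIdeal := by
  have := hj.isOpenImmersion
  rw [mem_range_iff_exists_boundaryIdeal]
  constructor
  · rintro ⟨r, hr, hrp⟩
    obtain ⟨m, hm, hmp⟩ := notMem_ideal_of_chi_mem hrp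
    exact ⟨m, chi_mem_of_torus_stable _
      (fun t f hf => hj.torusOnFunctions_mem_boundaryIdeal t hf) hr hm, hmp⟩
  · rintro ⟨m, hm, hmp⟩
    exact ⟨_, hm, hmp⟩

/-- The complement of the image of `X_Σ` in `X_σ` does not contain a divisor along which a Demazure
root has its pole. -/
theorem IsAffineModel.exists_chi_mem_boundaryIdeal [CharZero k] (hj : IsAffineModel Δ σ j)
    {s e : Fin n → ℤ} (h : IsDemazureRoot σ s e) (hm : ∃ m ∈ dualMonoid σ, 0 < s ⬝ᵥ m) :
    ∃ w : dualMonoid σ, chi k w ∈ boundaryIdeal j ∧ s ⬝ᵥ (w : Fin n → ℤ) = 0 := by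
  by_contra! hne
  let ι := ULift.{u} {w : dualMonoid σ // 0 < s ⬝ᵥ (w : Fin n → ℤ)}
  let w' : ι → dualMonoid σ := fun w => ⟨_, h.add_mem _ w.down.1.2 w.down.2⟩
  -- By `hne`, the sets D(χ^w) with ⟨s,w⟩ > 0 cover X; the fractions χ^{w+e}/χ^w glue to a global
  -- function, which should be χ^e.
  obtain ⟨f, hf⟩ := exists_section_mul_eq (fun w : ι => sectionsHom j (chi k w.down.1))
    (fun w : ι => sectionsHom j (chi k (w' w))) (fun x => by
      obtain ⟨m, hmI, hmx⟩ := (hj.mem_range_iff (j x)).1 ⟨x, rfl⟩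
      exact ⟨⟨m, lt_of_le_of_ne (h.nonneg m m.2) (Ne.symm (hne m hmI))⟩,
        (mem_basicOpen_sectionsHom j _ x).2 hmx⟩) (fun v w => by
      rw [← map_mul, ← map_mul, chi_mul, chi_mul]
      congr 2
      ext1
      simp only [w', AddSubmonoid.coe_add]
      abel)
  obtain ⟨r, rfl⟩ := hj.bijective_sectionsHom.2 f
  obtain ⟨m, hmP, hpos⟩ := hm
  have h1 := hf ⟨⟨⟨m, hmP⟩, hpos⟩⟩
  rw [← map_mul] at h1
  -- The function is some r in k[σ^∨_M] with r χ^m = χ^{m+e}. This forces the exponent e to occur in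
  -- r, but ⟨s,e⟩ = -1.
  have h2 := congrArg (fun f => f.coeff ⟨m + e, h.add_mem m hmP hpos⟩)
    (hj.bijective_sectionsHom.1 h1)
  simp only [w', chi] at h2
  rw [AddMonoidAlgebra.coeff_single, Finsupp.single_eq_same,
    AddMonoidAlgebra.coeff_mul_single_of_forall_add_ne] at h2
  · exact zero_ne_one h2
  · intro q hq
    have h3 : (q : Fin n → ℤ) = e := by
      have := congrArg Subtype.val hq
      simp only [AddSubmonoid.coe_add] at this
      rw [add_comm m e] at this
      exact add_right_cancel this
    have h4 := h.nonneg q q.2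
    rw [h3, h.eq_neg_one] at h4
    omega

end AffineModelBoundary

/-! ### The action of a Demazure root restricts to X -/

section Construction

open Polynomial

variable {k : Type u} [Field k] [CharZero k] {n : ℕ} {Δ : ConeFan n}
  {σ : PointedCone ℝ (Fin n → ℝ)}
  {j : toricVariety k Δ ⟶ Spec (CommRingCat.of (coordRing k σ))}

/-- The terms of `χ^m (1 + χ^e t)^⟨m,s⟩` belong to the boundary ideal together with `χ^m`, if
`χ^{m+e}` vanishes wherever a character `χ^w` with `⟨w,s⟩ = 0` does, for all `m` with
`⟨m,s⟩ > 0`. -/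
theorem IsAffineModel.chiOrZero_mem_boundaryIdeal (hj : IsAffineModel Δ σ j)
    {s e : Fin n → ℤ} (h : IsDemazureRoot σ s e)
    (hstrict : ∀ m ∈ dualMonoid σ, 0 < s ⬝ᵥ m → ∀ w ∈ dualMonoid σ, s ⬝ᵥ w = 0 →
      ∃ N : ℕ, N • (m + e) - w ∈ dualMonoid σ)
    (m : dualMonoid σ) (hm : chi k m ∈ boundaryIdeal j) {i : ℕ}
    (hi : i ≤ (s ⬝ᵥ (m : Fin n → ℤ)).toNat) :
    chiOrZero k σ (m + i • e) ∈ boundaryIdeal j := by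
  rcases i with _ | i
  · rw [zero_nsmul, add_zero, chiOrZero_of_mem m.2]
    exact hm
  have hmi := h.add_nsmul_mem m.2 (i := i) (by omega)
  have hpos : 0 < s ⬝ᵥ ((m : Fin n → ℤ) + i • e) := by
    rw [dotProduct_add, dotProduct_smul, h.eq_neg_one, nsmul_eq_mul]
    omega
  obtain ⟨w, hwI, hw⟩ := hj.exists_chi_mem_boundaryIdeal h ⟨_, hmi, hpos⟩
  obtain ⟨N, hN⟩ := hstrict _ hmi hpos w w.2 hw
  rw [chiOrZero_of_mem (h.add_nsmul_mem m.2 hi)]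
  -- The N-th power of this character is divisible by χ^w, which lies in the ideal.
  refine boundaryIdeal_isRadical j ⟨N, ?_⟩
  have h1 : chi k ⟨_, h.add_nsmul_mem m.2 hi⟩ ^ N = chi k ⟨_, hN⟩ * chi k w := by
    rw [chi_pow, chi_mul]
    congr 1
    ext1
    rw [AddSubmonoid.coe_add, sub_add_cancel, add_assoc, ← succ_nsmul]
    exact AddSubmonoidClass.coe_nsmul _ N
  rw [h1]
  exact Ideal.mul_mem_left _ _ hwI

/-- The additive group action on `X_σ` of a Demazure root preserves the image of `X_Σ`. -/
theorem IsAffineModel.range_subset_of_demazureCoaction (hj : IsAffineModel Δ σ j)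
    {s e : Fin n → ℤ} (h : IsDemazureRoot σ s e)
    (hstrict : ∀ m ∈ dualMonoid σ, 0 < s ⬝ᵥ m → ∀ w ∈ dualMonoid σ, s ⬝ᵥ w = 0 →
      ∃ N : ℕ, N • (m + e) - w ∈ dualMonoid σ)
    {S : Scheme.{u}} (x : S ⟶ toricVariety k Δ) (a : Γ(S, ⊤))
    (g : S ⟶ Spec (CommRingCat.of (coordRing k σ)))
    (hg : ∀ r, sectionsHom g r = (demazureCoaction k h r).eval₂ (sectionsHom (x ≫ j)) a) :
    Set.range g ⊆ Set.range j := by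
  rintro _ ⟨p, rfl⟩
  by_contra hp
  have hev : ∀ f : Γ(S, ⊤), f ∈ RingHom.ker (S.Γevaluation p).hom ↔ p ∉ S.basicOpen f := fun f =>
    S.evaluation_eq_zero_iff_notMem_basicOpen (U := ⊤) p trivial f
  have hvan : ∀ f ∈ boundaryIdeal j, sectionsHom g f ∈ RingHom.ker (S.Γevaluation p).hom := by
    intro f hf
    rw [hev, mem_basicOpen_sectionsHom, not_not]
    exact (mem_boundaryIdeal j).1 hf _ hp
  obtain ⟨m, hmI, hm⟩ := (hj.mem_range_iff (j (x p))).1 ⟨_, rfl⟩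
  rw [← Scheme.Hom.comp_apply, ← mem_basicOpen_sectionsHom] at hm
  refine (hev _).1 ?_ hm
  -- Flow back by -a: χ^m at x(p) becomes a combination of values at g(p) of characters in the
  -- ideal. These vanish in the residue field if g(p) is outside X, whereas χ^m was chosen nonzero
  -- at x(p).
  rw [← eval₂_zero_demazureCoaction h, ← neg_add_cancel a, eval₂_add_demazureCoaction,
    demazureCoaction_chi, eval₂_demazurePoly]
  refine Ideal.sum_mem _ fun i hi => Ideal.mul_mem_right _ _ (Ideal.mul_mem_left _ _ ?_)
  have h1 := hvan _ (hj.chiOrZero_mem_boundaryIdeal h hstrict m hmI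
    (Nat.lt_succ_iff.1 (Finset.mem_range.1 hi)))
  rw [hg] at h1
  exact h1

/-- The coaction defines 𝔸¹_X → X_σ, which factors through the open X. As `j` is a monomorphism and
maps to an affine scheme are determined by functions, the axioms follow from the identities for the
coaction. -/
theorem IsAffineModel.mem_weights (hj : IsAffineModel Δ σ j)
    {s e : Fin n → ℤ} (h : IsDemazureRoot σ s e)
    (hstrict : ∀ m ∈ dualMonoid σ, 0 < s ⬝ᵥ m → ∀ w ∈ dualMonoid σ, s ⬝ᵥ w = 0 →
      ∃ N : ℕ, N • (m + e) - w ∈ dualMonoid σ)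
    (hpos : ∃ m ∈ dualMonoid σ, 0 < s ⬝ᵥ m) : e ∈ weights k Δ := by
  have := hj.isOpenImmersion
  let E : coordRing k σ →+* (coordRing k σ)[X] := demazureCoaction k h
  let π := 𝔸(PUnit.{u + 1}; toricVariety k Δ) ↘ toricVariety k Δ
  let g := homOfSections ((polynomialToSections j).comp E)
  have hg : sectionsHom g = (polynomialToSections j).comp E := sectionsHom_homOfSections _
  have hrange : Set.range g ⊆ Set.range j :=
    hj.range_subset_of_demazureCoaction h hstrict π (AffineSpace.coord _ PUnit.unit) g
      (RingHom.congr_fun hg)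
  let act := IsOpenImmersion.lift j g hrange
  have hact : act ≫ j = g := IsOpenImmersion.lift_fac _ _ _
  have hmove : ∀ {S : Scheme.{u}} (x : S ⟶ toricVariety k Δ) (a : Γ(S, ⊤)) (r : coordRing k σ),
      sectionsHom ((AffineSpace.homOfVector x (fun _ => a) ≫ act) ≫ j) r =
        (demazureCoaction k h r).eval₂ (sectionsHom (x ≫ j)) a := by
    intro S x a r
    rw [Category.assoc, hact, sectionsHom_comp, hg]
    exact homOfVector_appTop_polynomialToSections j x a _
  have hext : ∀ {S : Scheme.{u}} {x y : S ⟶ toricVariety k Δ},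
      (∀ r, sectionsHom (x ≫ j) r = sectionsHom (y ≫ j) r) → x = y := fun hxy =>
    (cancel_mono j).1 (sectionsHom_injective (RingHom.ext hxy))
  have hC : ∀ r, sectionsHom (π ≫ j) r = polynomialToSections j (C r) := by
    intro r
    simp [polynomialToSections, π]
  let ε : GaAction (toricStr k Δ) :=
    { act := act
      act_over := by
        apply sectionsHom_injective
        refine RingHom.ext fun c => ?_
        change constant (act ≫ toricStr k Δ) c = constant (π ≫ toricStr k Δ) c
        rw [hj.constant_eq, hj.constant_eq, hact, hg, hC, RingHom.comp_apply]
        exact congrArg _ ((demazureCoaction k h).commutes c)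
      zero_act := fun x => hext fun r => by
        rw [hmove, eval₂_zero_demazureCoaction]
      add_act := fun x a b => hext fun r => by
        rw [hmove, hmove, eval₂_add_demazureCoaction]
        congr 1
        exact RingHom.ext fun r => (hmove x b r).symm }
  refine ⟨ε, fun htriv => ?_, fun t S a x => hext fun r => ?_⟩
  · obtain ⟨r, hr⟩ := demazureCoaction_ne (k := k) h hpos
    apply hr
    apply hj.bijective_polynomialToSections.1
    have htriv' : act = π := htriv
    rw [← hC, ← htriv', hact, hg]
    rfl
  · rw [hj.sectionsHom_torusAct, RingHom.comp_apply, RingHom.coe_coe]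
    refine (hmove _ _ _).trans ?_
    refine Eq.trans ?_ (hmove _ _ _).symm
    rw [hj.sectionsHom_torusAct, inv_inv, hj.constant_eq]
    exact demazureCoaction_homogeneous h _ a t r

/-- A lattice vector `e` with `⟨e,s⟩ = -1` which is positive on the other ray generators of `σ` is
the weight of a nontrivial homogeneous `𝔾ₐ`-action. -/
theorem IsAffineModel.mem_weights_of_generators (hj : IsAffineModel Δ σ j)
    (S : Finset (Fin n → ℤ)) (hσ : σ = PointedCone.hull ℝ (toReal '' (S : Set (Fin n → ℤ))))
    (hS : ∃ u : Fin n → ℤ, ∀ s ∈ S, 0 < s ⬝ᵥ u) {s e : Fin n → ℤ} (hs : s ∈ S)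
    (he : s ⬝ᵥ e = -1) (hpos : ∀ s' ∈ S, s' ≠ s → 0 < s' ⬝ᵥ e) : e ∈ weights k Δ := by
  classical
  have hmem : ∀ m, m ∈ dualMonoid σ ↔ ∀ s ∈ S, 0 ≤ s ⬝ᵥ m := by
    intro m
    rw [hσ, mem_dualMonoid_hull]
    rfl
  have h : IsDemazureRoot σ s e :=
    { nonneg := fun m hm => (hmem m).1 hm s hs
      eq_neg_one := he
      add_mem := fun m hm hsm => (hmem _).2 fun s' hs' => by
        rw [dotProduct_add]
        by_cases hss : s' = s
        · rw [hss, he]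
          omega
        · exact add_nonneg ((hmem m).1 hm s' hs') (hpos s' hs' hss).le }
  obtain ⟨u, hu⟩ := hS
  refine hj.mem_weights h (fun m hm hsm w hw hsw => ?_)
    ⟨u, (hmem u).2 fun s hs => (hu s hs).le, hu s hs⟩
  -- On s' ≠ s the strict positivity of e gives ⟨s',m+e⟩ ≥ 1, so this multiple dominates w; on s, w
  -- pairs to zero and ⟨s,m+e⟩ ≥ 0.
  refine ⟨∑ s' ∈ S, (s' ⬝ᵥ w).toNat, (hmem _).2 fun s' hs' => ?_⟩
  rw [dotProduct_sub, dotProduct_smul, nsmul_eq_mul]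
  have h1 := (hmem _).1 (h.add_mem m hm hsm) s' hs'
  by_cases hss : s' = s
  · rw [hss] at h1 ⊢
    rw [hsw, sub_zero]
    exact mul_nonneg (Nat.cast_nonneg _) h1
  · have h2 : 0 < s' ⬝ᵥ (m + e) := by
      rw [dotProduct_add]
      exact add_pos_of_nonneg_of_pos ((hmem m).1 hm s' hs') (hpos s' hs' hss)
    have h3 : (s' ⬝ᵥ w).toNat ≤ ∑ s' ∈ S, (s' ⬝ᵥ w).toNat :=
      Finset.single_le_sum (f := fun s' => (s' ⬝ᵥ w).toNat) (fun _ _ => Nat.zero_le _) hs'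
    have h4 : s' ⬝ᵥ w ≤ ((∑ s' ∈ S, (s' ⬝ᵥ w).toNat : ℕ) : ℤ) := by omega
    nlinarith

end Construction

end Toric

end

/-! ### The two inclusions -/

theorem mainTheorem5 {k : Type u} [Field k] [IsAlgClosed k] [CharZero k] {n : ℕ}
    (Δ : Toric.ConeFan n) (hX : (Toric.toricVariety k Δ).IsQuasiAffine)
    (σ : PointedCone ℝ (Fin n → ℝ)) (hσ : Toric.IsRationalCone σ)
    (hXσ : Toric.AffinizationIs k Δ σ) :
    asymptoticCone ℝ (Toric.toReal '' Toric.weights k Δ) =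
      (Toric.dualCone σ : Set (Fin n → ℝ)) \
        intrinsicInterior ℝ (Toric.dualCone σ : Set (Fin n → ℝ)) := by
  obtain ⟨S, hS, hu, hgen⟩ := hσ.exists_primitive_generators
  obtain ⟨j, hj⟩ := Toric.exists_isAffineModel hX hXσ
  apply Set.Subset.antisymm
  · obtain ⟨C, hC⟩ := Toric.exists_bound_of_derivation k S hu hS
    rw [hS]
    refine Toric.asymptoticCone_subset_boundary S hu _ C fun e he => ?_
    obtain ⟨D, hD, hD0, hnil⟩ := hj.exists_derivation he
    refine ⟨hC D e hD hD0, ?_⟩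
    have h1 := Toric.notMem_dualMonoid_of_locallyNilpotent hD hD0 hnil
    rw [hS, Toric.mem_dualMonoid_hull] at h1
    push Not at h1
    exact h1
  · rintro x ⟨hx, hxi⟩
    have hx' : ∀ s ∈ S, 0 ≤ Toric.toReal s ⬝ᵥ x := by
      rw [hS] at hx
      exact (Toric.mem_dualCone_hull _ _).1 hx
    have h1 : ∃ s ∈ S, Toric.toReal s ⬝ᵥ x = 0 := by
      by_contra! h
      apply hxi
      rw [hS]
      exact Toric.mem_intrinsicInterior_dualCone S fun s hs =>
        lt_of_le_of_ne (hx' s hs) (Ne.symm (h s hs))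
    obtain ⟨s, hs, hsx⟩ := h1
    refine asymptoticCone_mono (Set.image_mono ?_)
      (Toric.mem_asymptoticCone_demazure S s (hgen s hs).1 (hgen s hs).2 hx' hsx)
    rintro e ⟨he, hpos⟩
    exact hj.mem_weights_of_generators S hS hu hs he hpos
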